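/- Let $\Psi$ be a (strictly) stationary random field on $\mathbb{R}^d$ with continuous sample paths which is almost surely strictly positive (almost surely, $\Psi(s)>0$ for all $s$) and satisfies $c_\Psi=\mathbb{E}\,\Psi(o)<\infty$, where $o$ is the origin. Let $X$ be a non-negative random field on $\mathbb{R}^d$ with continuous sample paths and law $\mathbb{P}_X$ on $C(\mathbb{R}^d)$ (equipped with the topology of locally uniform convergence) such that $$\mathbb{E}_X\Big(\int_{\mathbb{R}^d}\sup_{t\in K}X(t-s)\,\mathrm{d}s\Big)<\infty\quad\text{for every compact }K\subset\mathbb{R}^d$$ and such that there is $r>0$ with $\mathbb{P}_X\big(X(s)>0\text{ for all } s \text{ with } \|s\|\le r\big)>0$. Let $\mu_Y,\mu_Z>0$ be constants. Let $Y(t)=\bigvee_{i\ge1}u_iX_i(t-s_i)$, $t\in\mathbb{R}^d$, where $\sum_{i\ge 1}\delta_{(s_i,u_i,X_i)}$ is a Cox process on $\mathbb{R}^d\times(0,\infty]\times C(\mathbb{R}^d)$ directed by the random measure $\mathrm{d}\Lambda(s,u,x)=\mu_Y^{-1}\Psi(s)\,\mathrm{d}s\,u^{-2}\,\mathrm{d}u\,\mathrm{d}\mathbb{P}_X(x)$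 (that is, conditionally on $\Lambda$ it is a Poisson process with directing measure $\Lambda$). Let $Z(t)=\bigvee_{i\ge1}u_iX_i(t-s_i)$, where now $\sum_{i\ge 1}\delta_{(s_i,u_i,X_i)}$ is a Poisson process with directing measure $\mu_Z^{-1}\,\mathrm{d}s\,u^{-2}\,\mathrm{d}u\,\mathrm{d}\mathbb{P}_X(x)$. Then, almost surely, the random fields $Y$ and $Z$ are finite on compact sets (their suprema over compact sets are finite) and have continuous sample paths, and $Y$ lies in the max-domain of attraction of $Z$: if $Y_1,Y_2,\dots$ are i.i.d. copies of $Y$, there are continuous functions $a_n>0$ and $b_n$ on $\mathbb{R}^d$ such that $a_n\big(\bigvee_{i=1}^nY_i-b_n\big)$ converges weakly in $C(\mathbb{R}^d)$ to $Z$. More precisely, if $$\mu_Y=\mathbb{E}_\Psi\Big(\mathbb{E}_X\int_{\mathbb{R}^d}X(t-s)\Psi(s)\,\mathrm{d}s\Big)$$ (for some $t\in\mathbb{R}^d$; the value $c_\Psi\,\mathbb{E}_X\int_{\mathbb{R}^d} X(s)\,\mathrm{d}s$ does not depend on $t$) and $\mu_Z=\mu_Y/c_\Psi$, then $$n^{-1}\bigvee_{i=1}^nY_i\longrightarrow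 Z\qquad\text{weakly in }C(\mathbb{R}^d)\text{ as }n\to\infty.$$ -/

import Mathlib

open MeasureTheory ProbabilityTheory Filter Set
open scoped ENNReal NNReal Topology Nat

noncomputable section

namespace CoxExtremal

/-- `d`-dimensional Euclidean space. -/
abbrev Space (d : ℕ) : Type := EuclideanSpace ℝ (Fin d)

/-- The space `C(ℝᵈ)` of continuous real functions; Mathlib's topology on it is the compact-open
topology, i.e. that of locally uniform convergence (the usual Fréchet topology). -/
abbrev Path (d : ℕ) : Type := C(Space d, ℝ)

/-- `C(ℝᵈ)` carries its Borel σ-algebra. -/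
instance instMeasurableSpacePath (d : ℕ) : MeasurableSpace (Path d) := borel (Path d)

instance instBorelSpacePath (d : ℕ) : BorelSpace (Path d) := ⟨rfl⟩

/-- The space of triples `(s, u, x)`: storm centre, severity and storm shape. The severity is
recorded as a real number; all directing measures used below are carried by `u > 0`. -/
abbrev Mark (d : ℕ) : Type := Space d × ℝ × Path d

section PointProcesses

variable {Ω S : Type*} [MeasurableSpace Ω] [MeasurableSpace S]

/-- The random counting measure `∑ᵢ δ_{pᵢ}` with points `p₀, p₁, …`. -/
def pointMeasure (p : ℕ → Ω → S) (ω : Ω) : Measure S :=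
  Measure.sum fun i => Measure.dirac (p i ω)

/-- `N` is a Poisson process with directing measure `lam`: `N B` is Poisson distributed with
parameter `lam B` whenever `lam B < ∞`, and the counts of disjoint measurable sets are
independent. -/
structure IsPoissonProcess (N : Ω → Measure S) (lam : Measure S) (P : Measure Ω) : Prop where
  measurable_process : Measurable N
  law_count : ∀ B : Set S, MeasurableSet B → lam B < ∞ →
    P.map (fun ω => N ω B) =
      (poissonMeasure (lam B).toNNReal).map (fun n : ℕ => (n : ℝ≥0∞))
  indep_count : ∀ (k : ℕ) (B : Fin k → Set S), (∀ j, MeasurableSet (B j)) →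
    Pairwise (fun i j => Disjoint (B i) (B j)) → iIndepFun (fun j ω => N ω (B j)) P

/-- `N` is a Cox process directed by the random measure `Lam`: conditionally on `Lam`, it is a
Poisson process with directing measure `Lam`. That is, given `Lam`, the counts of disjoint
measurable sets `B₁, …, B_k` are independent and Poisson distributed with parameters `Lam B_j`
(on the event that these parameters are finite). -/
structure IsCoxProcess (N Lam : Ω → Measure S) (P : Measure Ω) : Prop where
  measurable_process : Measurable N
  measurable_directing : Measurable Lam
  cond_count : ∀ (k : ℕ) (B : Fin k → Set S), (∀ j, MeasurableSet (B j)) →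
    Pairwise (fun i j => Disjoint (B i) (B j)) → ∀ m : Fin k → ℕ,
      ∀ᵐ ω ∂P, (∀ j, Lam ω (B j) < ∞) →
        (P⟦{ω' | ∀ j, N ω' (B j) = (m j : ℝ≥0∞)} |
            MeasurableSpace.comap Lam Measure.instMeasurableSpace⟧) ω =
          ∏ j, Real.exp (-(Lam ω (B j)).toReal) * (Lam ω (B j)).toReal ^ m j / ((m j)! : ℝ)

end PointProcesses

section Fields

variable {d : ℕ} {Ω Ω' : Type*} [MeasurableSpace Ω] [MeasurableSpace Ω']

/-- The measure `μ⁻¹ ψ(s) ds × u⁻² du × P_X(dx)` on `ℝᵈ × (0, ∞) × C(ℝᵈ)`. -/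
def stormIntensity (μ : ℝ) (ψ : Space d → ℝ) (PX : Measure (Path d)) : Measure (Mark d) :=
  ENNReal.ofReal μ⁻¹ •
    ((volume : Measure (Space d)).withDensity (fun s => ENNReal.ofReal (ψ s))).prod
      ((((volume : Measure ℝ).restrict (Ioi 0)).withDensity
        (fun u => ENNReal.ofReal (u ^ 2)⁻¹)).prod PX)

/-- The extremal field `t ↦ ⋁ᵢ uᵢ Xᵢ(t - sᵢ)`, a priori with values in `[0, ∞]`, built from the
points `pᵢ = (sᵢ, uᵢ, Xᵢ)`. -/
def extremalField (p : ℕ → Ω → Mark d) (ω : Ω) (t : Space d) : ℝ≥0∞ :=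
  ⨆ i, ENNReal.ofReal ((p i ω).2.1 * (p i ω).2.2 (t - (p i ω).1))

open Classical in
/-- A `[0, ∞]`-valued function regarded as an element of `C(ℝᵈ)`, when it is finite and
continuous. (The value `0` otherwise is irrelevant: it is used only for fields whose
paths are almost surely finite and continuous.) -/
def toPath (f : Space d → ℝ≥0∞) : Path d :=
  if h : (∀ t, f t < ∞) ∧ Continuous (fun t => (f t).toReal) then
    ⟨fun t => (f t).toReal, h.2⟩
  else 0

/-- Almost surely, the field `Y` is bounded on every compact set by a finite number and has
continuous sample paths; and it thereby is (up to a null set) a random element of `C(ℝᵈ)`. -/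
def FiniteAndSampleContinuous (Y : Ω → Space d → ℝ≥0∞) (P : Measure Ω) : Prop :=
  (∀ᵐ ω ∂P, (∀ K : Set (Space d), IsCompact K → (⨆ t ∈ K, Y ω t) < ∞) ∧
    Continuous (fun t => (Y ω t).toReal)) ∧
  AEMeasurable (fun ω => toPath (Y ω)) P

/-- Strict stationarity: the finite-dimensional distributions are translation invariant. -/
def IsStationary (Psi : Ω → Path d) (P : Measure Ω) : Prop :=
  ∀ (h : Space d) (k : ℕ) (t : Fin k → Space d),
    IdentDistrib (fun ω (j : Fin k) => Psi ω (t j + h)) (fun ω (j : Fin k) => Psi ω (t j)) P P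

/-- `E_X ∫ sup_{t ∈ K} X(t - s) ds < ∞` for all compact `K`. -/
def StormIntegrable (PX : Measure (Path d)) : Prop :=
  ∀ K : Set (Space d), IsCompact K →
    (∫⁻ x, ∫⁻ s, (⨆ t ∈ K, ENNReal.ofReal (x (t - s))) ∂volume ∂PX) < ∞

/-- With positive probability `X` is strictly positive on some fixed closed ball around the
origin. -/
def StormSupport (PX : Measure (Path d)) : Prop :=
  ∃ r : ℝ, 0 < r ∧ 0 < PX {x | Metric.closedBall (0 : Space d) r ⊆ {s | 0 < x s}}

/-- `E_Ψ (E_X ∫ X(t - s) Ψ(s) ds)`. -/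
def meanStormIntegral (Psi : Ω → Path d) (P : Measure Ω) (PX : Measure (Path d))
    (t : Space d) : ℝ≥0∞ :=
  ∫⁻ ω, ∫⁻ x, ∫⁻ s, ENNReal.ofReal (x (t - s)) * ENNReal.ofReal (Psi ω s) ∂volume ∂PX ∂P

/-- `Y₀, Y₁, …` are independent copies of the random element `Y` of `C(ℝᵈ)`. -/
def AreIIDCopies (Yc : ℕ → Ω' → Path d) (P' : Measure Ω') (Y : Ω → Path d)
    (P : Measure Ω) : Prop :=
  iIndepFun Yc P' ∧ ∀ i, IdentDistrib (Yc i) Y P' P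

/-- The pointwise maximum of the first `n + 1` random functions. -/
def maxFirst (Yc : ℕ → Ω' → Path d) (n : ℕ) (ω : Ω') : Path d :=
  (Finset.range (n + 1)).sup' Finset.nonempty_range_add_one (fun i => Yc i ω)

/-- The common law of the i.i.d. sequence `Y₀, Y₁, …` is in the max-domain of attraction of `Z`:
for suitable continuous norming functions `aₙ > 0` and `bₙ`, the fields `aₙ (⋁_{i ≤ n} Yᵢ - bₙ)`
converge weakly in `C(ℝᵈ)` to `Z`. -/
def InMaxDomainOfAttraction (Yc : ℕ → Ω' → Path d) (P' : Measure Ω') [IsProbabilityMeasure P']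
    (Z : Ω → Path d) (Q : Measure Ω) [IsProbabilityMeasure Q] : Prop :=
  ∃ a b : ℕ → Path d, (∀ n t, 0 < a n t) ∧
    TendstoInDistribution (fun n ω => a n * (maxFirst Yc n ω - b n)) atTop Z (fun _ => P') Q

end Fields

end CoxExtremal

end

/-!
Both fields are upper envelopes of a random locally finite set `R` of continuous functions, the
storms `t ↦ uᵢ Xᵢ(t - sᵢ)`: almost surely only finitely many elements of `R` exceed a given level
`η > 0` on a given compact set `K`. Partition the functions exceeding `η` on `K` into countably many
cells of small uniform diameter on `K`. Two envelopes whose random sets hit the same cells are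
uniformly close on `K`, and the probability of each hit pattern is determined, by inclusion and
exclusion, by the avoidance probabilities `P (R ∩ D = ∅)`. Hence convergence of the avoidance
probabilities implies weak convergence of the envelopes in `C(ℝᵈ)`.

For the Cox process directed by `Λ` the avoidance probability of `D` is `E exp (-Λ(D))`. The
normalised maximum of `n` copies is the envelope of the union of `n` independent copies of `R`
scaled by `c / n`. Scaling the storms by `c / n` multiplies the directing measure by the same factor
because of the density `u⁻²`, so the avoidance probability of this union is
`(E exp (-c Λ(D) / n)) ^ n`, which tends to `exp (-c E Λ(D))`. By stationarity of `Ψ`, the measure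
`c E Λ` is the directing measure of the Poisson process underlying `Z` for the right choice of `c`.
-/

noncomputable section

namespace CoxExtremal

open scoped Pointwise

section Envelope

variable {T : Type*} [TopologicalSpace T]

/-- The continuous functions that exceed the level `η` somewhere on `K`. -/
def exceedSet (K : Set T) (η : ℝ) : Set C(T, ℝ) := {f | ∃ t ∈ K, η < f t}

/-- The upper envelope `t ↦ ⋁_{f ∈ R} f(t)⁺` of a set of continuous functions, with values in
`[0, ∞]`. -/
def envelope (R : Set C(T, ℝ)) (t : T) : ℝ≥0∞ := ⨆ f ∈ R, ENNReal.ofReal (f t)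

/-- Local finiteness of a set `R` of continuous functions away from zero: on any compact set, only
finitely many members of `R` exceed a given positive level. -/
def HasFiniteExceedances (R : Set C(T, ℝ)) : Prop :=
  ∀ K, IsCompact K → ∀ η > 0, (R ∩ exceedSet K η).Finite

/-- The non-negative continuous function `f` is the upper envelope of `R`. -/
def IsEnvelope (f : C(T, ℝ)) (R : Set C(T, ℝ)) : Prop :=
  ∀ t, 0 ≤ f t ∧ ENNReal.ofReal (f t) = envelope R t

variable {K K' : Set T} {η η' : ℝ} {R R' : Set C(T, ℝ)} {f f' : C(T, ℝ)} {t : T}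

lemma isOpen_exceedSet (K : Set T) (η : ℝ) : IsOpen (exceedSet K η) := by
  have h_union : exceedSet K η = ⋃ t ∈ K, {f : C(T, ℝ) | η < f t} := by
    ext f; simp [exceedSet]
  rw [h_union]
  exact isOpen_biUnion fun t _ =>
    isOpen_lt continuous_const (continuous_eval_const (F := C(T, ℝ)) t)

lemma exceedSet_subset_exceedSet (hK : K ⊆ K') (hη : η' ≤ η) :
    exceedSet K η ⊆ exceedSet K' η' :=
  fun _ ⟨t, ht, hf⟩ => ⟨t, hK ht, hη.trans_lt hf⟩

lemma envelope_mono (h : R ⊆ R') (t : T) : envelope R t ≤ envelope R' t :=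
  biSup_mono h

lemma envelope_iUnion {ι : Sort*} (R : ι → Set C(T, ℝ)) (t : T) :
    envelope (⋃ i, R i) t = ⨆ i, envelope (R i) t :=
  iSup_iUnion R _

lemma envelope_smul {a : ℝ} (ha : 0 ≤ a) (R : Set C(T, ℝ)) (t : T) :
    envelope (a • R) t = ENNReal.ofReal a * envelope R t := by
  simp only [envelope, ENNReal.mul_iSup, ← image_smul, iSup_image, ContinuousMap.smul_apply,
    smul_eq_mul, ENNReal.ofReal_mul ha]

lemma envelope_le_max (R : Set C(T, ℝ)) (η : ℝ) (ht : t ∈ K) :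
    envelope R t ≤ max (envelope (R ∩ exceedSet K η) t) (ENNReal.ofReal η) := by
  refine iSup₂_le fun f hf => ?_
  rcases le_or_gt (f t) η with hη | hη
  · exact le_max_of_le_right (ENNReal.ofReal_le_ofReal hη)
  · exact le_max_of_le_left
      (le_iSup₂_of_le (f := fun (g : C(T, ℝ)) _ => ENNReal.ofReal (g t)) f ⟨hf, t, ht, hη⟩ le_rfl)

lemma envelope_coe (R : Finset C(T, ℝ)) (t : T) :
    envelope (R : Set C(T, ℝ)) t = R.sup fun f => ENNReal.ofReal (f t) :=
  (Finset.sup_eq_iSup R _).symm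

lemma envelope_lt_top_of_finite (hR : R.Finite) (t : T) : envelope R t < ∞ := by
  lift R to Finset C(T, ℝ) using hR
  rw [envelope_coe, Finset.sup_lt_iff ENNReal.zero_lt_top]
  exact fun f _ => ENNReal.ofReal_lt_top

lemma continuous_envelope_of_finite (hR : R.Finite) : Continuous (envelope R) := by
  lift R to Finset C(T, ℝ) using hR
  rw [funext (envelope_coe R)]
  exact Continuous.finset_sup_apply fun f _ => ENNReal.continuous_ofReal.comp f.continuous

lemma lowerSemicontinuous_envelope (R : Set C(T, ℝ)) : LowerSemicontinuous (envelope R) :=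
  lowerSemicontinuous_biSup fun f _ =>
    (ENNReal.continuous_ofReal.comp f.continuous).lowerSemicontinuous

namespace HasFiniteExceedances

lemma envelope_lt_top (hR : HasFiniteExceedances R) (t : T) : envelope R t < ∞ :=
  (envelope_le_max R 1 (mem_singleton t)).trans_lt <| max_lt
    (envelope_lt_top_of_finite (hR _ isCompact_singleton 1 one_pos) t) ENNReal.ofReal_lt_top

lemma continuous_envelope [WeaklyLocallyCompactSpace T] (hR : HasFiniteExceedances R) :
    Continuous (envelope R) := by
  refine continuous_iff_lower_upperSemicontinuous.2
    ⟨lowerSemicontinuous_envelope R, fun t₀ y hy => ?_⟩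
  obtain ⟨K, hK, hKt₀⟩ := exists_compact_mem_nhds t₀
  obtain ⟨η, hη, hηy⟩ : ∃ η : ℝ, 0 < η ∧ ENNReal.ofReal η < y := by
    obtain ⟨η, hη, hηy⟩ := ENNReal.lt_iff_exists_nnreal_btwn.1 (zero_le.trans_lt hy)
    exact ⟨η, by exact_mod_cast hη, by simpa using hηy⟩
  have h_cont := continuous_envelope_of_finite (hR K hK η hη)
  have h_lt : ∀ᶠ t in 𝓝 t₀, envelope (R ∩ exceedSet K η) t < y :=
    h_cont.continuousAt.eventually_lt_const
      ((envelope_mono inter_subset_left t₀).trans_lt hy)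
  filter_upwards [h_lt, hKt₀] with t ht htK
  exact (envelope_le_max R η htK).trans_lt (max_lt ht hηy)

lemma iSup_envelope_lt_top [WeaklyLocallyCompactSpace T] (hR : HasFiniteExceedances R)
    (hK : IsCompact K) : ⨆ t ∈ K, envelope R t < ∞ := by
  rcases K.eq_empty_or_nonempty with rfl | hne
  · simp
  · obtain ⟨t₀, -, ht₀⟩ := hK.exists_isMaxOn hne hR.continuous_envelope.continuousOn
    exact (iSup₂_le fun t ht => ht₀ ht).trans_lt (hR.envelope_lt_top t₀)

lemma continuous_toReal_envelope [WeaklyLocallyCompactSpace T] (hR : HasFiniteExceedances R) :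
    Continuous fun t => (envelope R t).toReal :=
  ENNReal.continuousOn_toReal.comp_continuous hR.continuous_envelope
    fun t => (hR.envelope_lt_top t).ne

end HasFiniteExceedances

namespace IsEnvelope

lemma smul {a : ℝ} (ha : 0 ≤ a) (hf : IsEnvelope f R) : IsEnvelope (a • f) (a • R) := fun t =>
  ⟨mul_nonneg ha (hf t).1, by
    rw [envelope_smul ha, ← (hf t).2, ← ENNReal.ofReal_mul ha]; rfl⟩

lemma finset_sup' {ι : Type*} {s : Finset ι} (hs : s.Nonempty) {f : ι → C(T, ℝ)}
    {R : ι → Set C(T, ℝ)} (hf : ∀ i ∈ s, IsEnvelope (f i) (R i)) :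
    IsEnvelope (s.sup' hs f) (⋃ i ∈ s, R i) := fun t => by
  rw [ContinuousMap.sup'_apply]
  refine ⟨?_, ?_⟩
  · obtain ⟨i, hi⟩ := hs
    exact (hf i hi t).1.trans (Finset.le_sup' (fun i => f i t) hi)
  · rw [Finset.apply_sup'_eq_sup'_comp hs _ fun x y => ENNReal.ofReal_max x y]
    simp only [envelope_iUnion, Finset.sup'_eq_sup, Finset.sup_eq_iSup, Function.comp_apply]
    exact iSup_congr fun i => iSup_congr fun hi => (hf i hi t).2

lemma abs_sub_le (hf : IsEnvelope f R) (hf' : IsEnvelope f' R') (hη : 0 ≤ η)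
    (h : envelope R t ≤ envelope R' t + ENNReal.ofReal η)
    (h' : envelope R' t ≤ envelope R t + ENNReal.ofReal η) : |f t - f' t| ≤ η := by
  have real_le {x y : ℝ} (hy : 0 ≤ y)
      (hxy : ENNReal.ofReal x ≤ ENNReal.ofReal y + ENNReal.ofReal η) : x ≤ y + η := by
    rwa [← ENNReal.ofReal_add hy hη, ENNReal.ofReal_le_ofReal_iff (by positivity)] at hxy
  rw [← (hf t).2, ← (hf' t).2] at h h'
  rw [abs_sub_le_iff]
  constructor
  · linarith [real_le (hf' t).1 h]
  · linarith [real_le (hf t).1 h']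

end IsEnvelope

end Envelope

section Tube

variable {T : Type*} [TopologicalSpace T]

/-- The continuous functions that are uniformly within `ε` of `g` on `K`. -/
def tube (K : Set T) (ε : ℝ) (g : C(T, ℝ)) : Set C(T, ℝ) :=
  {f | ∀ t ∈ K, |f t - g t| ≤ ε}

variable {K K' : Set T} {ε ε' η : ℝ}

lemma mem_tube_self (K : Set T) (hε : 0 ≤ ε) (g : C(T, ℝ)) : g ∈ tube K ε g :=
  fun t _ => by rwa [sub_self, abs_zero]

lemma tube_subset_tube (hK : K ⊆ K') (hε : ε' ≤ ε) (g : C(T, ℝ)) :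
    tube K' ε' g ⊆ tube K ε g :=
  fun _ hf t ht => (hf t (hK ht)).trans hε

lemma isClosed_tube (K : Set T) (ε : ℝ) (g : C(T, ℝ)) : IsClosed (tube K ε g) := by
  have h_inter : tube K ε g = ⋂ t ∈ K, {f : C(T, ℝ) | |f t - g t| ≤ ε} := by
    ext f; simp [tube]
  rw [h_inter]
  exact isClosed_biInter fun t _ => isClosed_le
    ((continuous_eval_const (F := C(T, ℝ)) t).sub continuous_const).abs continuous_const

lemma tube_mem_nhds (hK : IsCompact K) (hε : 0 < ε) (g : C(T, ℝ)) : tube K ε g ∈ 𝓝 g := by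
  have h_basis := nhds_basis_uniformity
    (ContinuousMap.hasBasis_compactConvergenceUniformity (α := T) (β := ℝ)) (x := g)
  refine mem_of_superset (h_basis.mem_of_mem (i := (K, {p : ℝ × ℝ | dist p.1 p.2 < ε}))
    ⟨hK, Metric.dist_mem_uniformity hε⟩) fun f hf t ht => ?_
  exact le_of_lt (hf t ht)

lemma exists_tube_subset (E : CompactExhaustion T) {G : Set C(T, ℝ)} (hG : IsOpen G)
    {g : C(T, ℝ)} (hg : g ∈ G) : ∃ n : ℕ, tube (E n) (1 / ((n : ℝ) + 1)) g ⊆ G := by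
  have h_basis := nhds_basis_uniformity
    (ContinuousMap.hasBasis_compactConvergenceUniformity (α := T) (β := ℝ)) (x := g)
  obtain ⟨⟨K, V⟩, ⟨hK, hV⟩, hKV⟩ := h_basis.mem_iff.1 (hG.mem_nhds hg)
  obtain ⟨ε, hε, hεV⟩ := Metric.mem_uniformity_dist.1 hV
  obtain ⟨n₁, hn₁⟩ := E.exists_superset_of_isCompact hK
  obtain ⟨n₂, hn₂⟩ := exists_nat_one_div_lt hε
  refine ⟨max n₁ n₂, fun f hf => hKV fun t ht => hεV ?_⟩
  calc |f t - g t| ≤ 1 / ((max n₁ n₂ : ℕ) + 1 : ℝ) := hf t (E.subset (le_max_left n₁ n₂) (hn₁ ht))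
    _ ≤ 1 / ((n₂ : ℝ) + 1) := Nat.one_div_le_one_div (le_max_right n₁ n₂)
    _ < ε := hn₂

end Tube

section Measurability

variable {T : Type*} [TopologicalSpace T] [LocallyCompactSpace T] [SecondCountableTopology T]
  [MeasurableSpace C(T, ℝ)] [BorelSpace C(T, ℝ)]

-- Evaluation on a countable dense set is a continuous injection of the Polish space `C(T, ℝ)` into
-- a countable product of lines, hence a measurable embedding by the Lusin–Souslin theorem.
lemma measurable_of_measurable_eval {Ω : Type*} [MeasurableSpace Ω] {F : Ω → C(T, ℝ)}
    (hF : ∀ t, Measurable fun ω => F ω t) : Measurable F := by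
  obtain ⟨s, hsc, hsd⟩ := TopologicalSpace.exists_countable_dense T
  have := hsc.to_subtype
  let evalOn (f : C(T, ℝ)) (t : s) : ℝ := f t
  have h_cont : Continuous evalOn := continuous_pi fun t => continuous_eval_const (t : T)
  have h_inj : Function.Injective evalOn := fun f g hfg => DFunLike.coe_injective <|
    f.continuous.ext_on hsd g.continuous fun t ht => congrFun hfg ⟨t, ht⟩
  exact (h_cont.measurableEmbedding h_inj).measurable_comp_iff.1
    (measurable_pi_lambda _ fun t => hF t)

-- The cells are a disjointed cover by tubes around a dense sequence.
lemma exists_measurable_partition_exceedSet {K : Set T} (hK : IsCompact K) (η : ℝ) {ε : ℝ}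
    (hε : 0 < ε) : ∃ C : ℕ → Set C(T, ℝ), (∀ j, MeasurableSet (C j)) ∧
      Pairwise (Function.onFun Disjoint C) ∧ ⋃ j, C j = exceedSet K η ∧
      ∀ j, ∀ f ∈ C j, ∀ g ∈ C j, ∀ t ∈ K, |f t - g t| ≤ ε := by
  let tubes (j : ℕ) : Set C(T, ℝ) := tube K (ε / 2) (TopologicalSpace.denseSeq C(T, ℝ) j)
  refine ⟨fun j => exceedSet K η ∩ disjointed tubes j, fun j => ?_, fun i j hij => ?_, ?_, ?_⟩
  · exact (isOpen_exceedSet K η).measurableSet.inter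
      (MeasurableSet.disjointed (fun _ => (isClosed_tube K _ _).measurableSet) j)
  · exact (disjoint_disjointed tubes hij).mono inter_subset_right inter_subset_right
  · rw [← inter_iUnion, iUnion_disjointed]
    refine inter_eq_left.2 fun f _ => ?_
    obtain ⟨j, hj⟩ := (TopologicalSpace.denseRange_denseSeq C(T, ℝ)).mem_nhds
      (tube_mem_nhds hK (half_pos hε) f)
    exact mem_iUnion.2 ⟨j, fun t ht => abs_sub_comm (f t) _ ▸ hj t ht⟩
  · intro j f hf g hg t ht
    have hft := disjointed_subset tubes j hf.2 t ht
    have hgt := disjointed_subset tubes j hg.2 t ht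
    calc |f t - g t| ≤ _ := abs_sub_le _ (TopologicalSpace.denseSeq C(T, ℝ) j t) _
      _ ≤ ε / 2 + ε / 2 := add_le_add hft (abs_sub_comm (g t) _ ▸ hgt)
      _ = ε := add_halves ε

end Measurability

section RandomSets

variable {Ω S ι : Type*}

/-- The indices of the cells `C j` that the set `R` hits. -/
def hitIndices (C : ι → Set S) (R : Set S) : Set ι := {j | ¬ Disjoint R (C j)}

/-- The event that the random set `R` avoids `D` and hits `C j` for all `j ∈ s`; its probability
is determined by the avoidance probabilities through inclusion and exclusion over `s`. -/
def avoidHitEvent (R : Ω → Set S) (D : Set S) (C : ι → Set S) (s : Finset ι) : Set Ω :=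
  {ω | Disjoint (R ω) D ∧ ∀ j ∈ s, ¬ Disjoint (R ω) (C j)}

lemma avoidHitEvent_insert [DecidableEq ι] (R : Ω → Set S) (D : Set S) (C : ι → Set S)
    (s : Finset ι) (j : ι) :
    avoidHitEvent R D C (insert j s) =
      avoidHitEvent R D C s \ avoidHitEvent R (D ∪ C j) C s := by
  ext ω
  simp only [avoidHitEvent, mem_ofPred_eq, Set.mem_sdiff, Finset.forall_mem_insert,
    disjoint_union_right]
  tauto

lemma avoidHitEvent_subset (R : Ω → Set S) {D D' : Set S} (hD : D ⊆ D') (C : ι → Set S)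
    (s : Finset ι) : avoidHitEvent R D' C s ⊆ avoidHitEvent R D C s :=
  fun _ hω => ⟨hω.1.mono_right hD, hω.2⟩

lemma setOf_hitIndices_eq (R : Ω → Set S) (C : ι → Set S) (A : Finset ι) :
    {ω | hitIndices C (R ω) = A} = avoidHitEvent R (⋃ j ∉ A, C j) C A := by
  ext ω
  simp only [hitIndices, avoidHitEvent, mem_ofPred_eq, Set.ext_iff, Finset.mem_coe,
    disjoint_iUnion_right]
  exact ⟨fun h => ⟨fun j hj => not_not.1 fun hn => hj ((h j).1 hn), fun j hj => (h j).2 hj⟩,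
    fun h j => ⟨fun hn => not_not.1 fun hj => hn (h.1 j hj), h.2 j⟩⟩

lemma finite_hitIndices {C : ι → Set S} (hC : Pairwise (Function.onFun Disjoint C)) {R : Set S}
    (hR : (R ∩ ⋃ j, C j).Finite) : (hitIndices C R).Finite := by
  refine (hR.biUnion fun x _ => (Set.Subsingleton.finite
    fun i (hi : x ∈ C i) j (hj : x ∈ C j) => hC.eq (not_disjoint_iff.2 ⟨x, hi, hj⟩))).subset ?_
  intro j hj
  obtain ⟨x, hxR, hxj⟩ := not_disjoint_iff.1 hj
  exact mem_biUnion ⟨hxR, mem_iUnion.2 ⟨j, hxj⟩⟩ hxj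

variable [MeasurableSpace Ω] [MeasurableSpace S]

/-- A random subset of `S`, in the sense that avoiding a given measurable set is an event. -/
def IsRandomSet (R : Ω → Set S) : Prop :=
  ∀ D, MeasurableSet D → MeasurableSet {ω | Disjoint (R ω) D}

variable {P : Measure Ω} [IsFiniteMeasure P] {R : Ω → Set S} {D E : Set S} {C : ι → Set S}

lemma IsRandomSet.measurableSet_avoidHitEvent (hR : IsRandomSet R) (hD : MeasurableSet D)
    (hC : ∀ j, MeasurableSet (C j)) (s : Finset ι) :
    MeasurableSet (avoidHitEvent R D C s) := by
  have h_inter : avoidHitEvent R D C s =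
      {ω | Disjoint (R ω) D} ∩ ⋂ j ∈ s, {ω | Disjoint (R ω) (C j)}ᶜ := by
    ext ω; simp [avoidHitEvent]
  rw [h_inter]
  exact (hR D hD).inter (Finset.measurableSet_biInter s fun j _ => (hR _ (hC j)).compl)

lemma IsRandomSet.measure_avoidHitEvent_insert [DecidableEq ι] (hR : IsRandomSet R)
    (hD : MeasurableSet D) (hC : ∀ j, MeasurableSet (C j)) (s : Finset ι) (j : ι) :
    P (avoidHitEvent R D C (insert j s)) =
      P (avoidHitEvent R D C s) - P (avoidHitEvent R (D ∪ C j) C s) := by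
  rw [avoidHitEvent_insert]
  exact measure_sdiff (avoidHitEvent_subset R subset_union_left C s)
    (hR.measurableSet_avoidHitEvent (hD.union (hC j)) hC s).nullMeasurableSet
    (measure_ne_top _ _)

variable {Ω' : ℕ → Type*} [∀ n, MeasurableSpace (Ω' n)] {P' : ∀ n, Measure (Ω' n)}
  [∀ n, IsFiniteMeasure (P' n)] {R' : ∀ n, Ω' n → Set S}

lemma tendsto_measure_avoidHitEvent (hR : IsRandomSet R) (hR' : ∀ n, IsRandomSet (R' n))
    (hvoid : ∀ D ⊆ E, MeasurableSet D →
      Tendsto (fun n => P' n {ω | Disjoint (R' n ω) D}) atTop (𝓝 (P {ω | Disjoint (R ω) D})))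
    (hC : ∀ j, MeasurableSet (C j)) (hCE : ∀ j, C j ⊆ E) (s : Finset ι) (hD : MeasurableSet D)
    (hDE : D ⊆ E) : Tendsto (fun n => P' n (avoidHitEvent (R' n) D C s)) atTop
      (𝓝 (P (avoidHitEvent R D C s))) := by
  classical
  induction s using Finset.induction_on generalizing D with
  | empty => simpa [avoidHitEvent] using hvoid D hDE hD
  | insert j s _ ih =>
    simp only [hR.measure_avoidHitEvent_insert hD hC,
      fun n => (hR' n).measure_avoidHitEvent_insert hD hC (P := P' n)]
    exact ENNReal.Tendsto.sub (ih hD hDE) (ih (hD.union (hC j)) (union_subset hDE (hCE j)))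
      (Or.inl (measure_ne_top _ _))

-- The possible values of a finite random subset of `ι` form a countable set, so convergence of the
-- individual probabilities gives the liminf inequality for any family of values.
theorem measure_hitIndices_mem_le_liminf [Countable ι] (hR : IsRandomSet R)
    (hR' : ∀ n, IsRandomSet (R' n))
    (hvoid : ∀ D ⊆ E, MeasurableSet D →
      Tendsto (fun n => P' n {ω | Disjoint (R' n ω) D}) atTop (𝓝 (P {ω | Disjoint (R ω) D})))
    (hC : ∀ j, MeasurableSet (C j)) (hCE : ∀ j, C j ⊆ E)
    (hfin : ∀ᵐ ω ∂P, (hitIndices C (R ω)).Finite) (𝒜 : Set (Set ι)) :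
    P {ω | hitIndices C (R ω) ∈ 𝒜} ≤
      liminf (fun n => P' n {ω | hitIndices C (R' n ω) ∈ 𝒜}) atTop := by
  classical
  let ℱ : Set (Finset ι) := {A | (A : Set ι) ∈ 𝒜}
  have h_compl_meas (A : Finset ι) : MeasurableSet (⋃ j ∉ A, C j) :=
    .iUnion fun j => .iUnion fun _ => hC j
  have h_tendsto (A : Finset ι) : Tendsto (fun n => P' n {ω | hitIndices C (R' n ω) = A}) atTop
      (𝓝 (P {ω | hitIndices C (R ω) = A})) := by
    simp only [setOf_hitIndices_eq]
    exact tendsto_measure_avoidHitEvent hR hR' hvoid hC hCE A (h_compl_meas A)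
      (iUnion₂_subset fun j _ => hCE j)
  have h_cover : {ω | hitIndices C (R ω) ∈ 𝒜} ≤ᵐ[P]
      (⋃ A : ℱ, {ω | hitIndices C (R ω) = A.1} : Set Ω) := by
    filter_upwards [hfin] with ω hω hωA
    exact mem_iUnion.2
      ⟨⟨hω.toFinset, (congrArg (· ∈ 𝒜) hω.coe_toFinset).mpr hωA⟩, hω.coe_toFinset.symm⟩
  refine (measure_mono_ae h_cover).trans ((measure_iUnion_le _).trans ?_)
  rw [ENNReal.tsum_eq_iSup_sum]
  refine iSup_le fun s => ?_
  rw [← (tendsto_finsetSum s fun A _ => h_tendsto A.1).liminf_eq]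
  refine liminf_le_liminf (Eventually.of_forall fun n => ?_)
  rw [← measure_biUnion_finset]
  · refine measure_mono (iUnion₂_subset fun A _ ω hω => ?_)
    rw [mem_ofPred_eq, show hitIndices C (R' n ω) = _ from hω]
    exact A.2
  · exact fun A _ B _ hAB => disjoint_left.2 fun ω hA hB =>
      hAB (Subtype.ext (Finset.coe_injective (Eq.trans (Eq.symm hA) hB)))
  · intro A _
    rw [setOf_hitIndices_eq]
    exact (hR' n).measurableSet_avoidHitEvent (h_compl_meas A.1) hC A.1

end RandomSets

section WeakConvergence

variable {T : Type*} [TopologicalSpace T] {K : Set T} {η : ℝ} {C : ℕ → Set C(T, ℝ)}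
  {R R' : Set C(T, ℝ)} {f f' : C(T, ℝ)} {t : T}

lemma envelope_le_add_of_hitIndices_subset (hC : exceedSet K η ⊆ ⋃ j, C j)
    (hosc : ∀ j, ∀ f ∈ C j, ∀ g ∈ C j, ∀ t ∈ K, |f t - g t| ≤ η)
    (h : hitIndices C R ⊆ hitIndices C R') (ht : t ∈ K) :
    envelope R t ≤ envelope R' t + ENNReal.ofReal η := by
  refine iSup₂_le fun f hf => ?_
  rcases le_or_gt (f t) η with hft | hft
  · exact le_add_left (ENNReal.ofReal_le_ofReal hft)
  obtain ⟨j, hfj⟩ := mem_iUnion.1 (hC ⟨t, ht, hft⟩)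
  obtain ⟨g, hg, hgj⟩ := not_disjoint_iff.1 (h (not_disjoint_iff.2 ⟨f, hf, hfj⟩))
  have hfg : f t ≤ g t + η := by linarith [(abs_le.1 (hosc j f hfj g hgj t ht)).2]
  calc ENNReal.ofReal (f t) ≤ ENNReal.ofReal (g t) + ENNReal.ofReal η :=
        (ENNReal.ofReal_le_ofReal hfg).trans ENNReal.ofReal_add_le
    _ ≤ envelope R' t + ENNReal.ofReal η := by
        gcongr; exact le_iSup₂ (f := fun (g : C(T, ℝ)) _ => ENNReal.ofReal (g t)) g hg

lemma IsEnvelope.mem_tube_of_hitIndices_eq (hf : IsEnvelope f R) (hf' : IsEnvelope f' R')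
    (hη : 0 ≤ η) (hC : exceedSet K η ⊆ ⋃ j, C j)
    (hosc : ∀ j, ∀ f ∈ C j, ∀ g ∈ C j, ∀ t ∈ K, |f t - g t| ≤ η)
    (h : hitIndices C R = hitIndices C R') : f ∈ tube K η f' := fun _ ht =>
  hf.abs_sub_le hf' hη (envelope_le_add_of_hitIndices_subset hC hosc h.subset ht)
    (envelope_le_add_of_hitIndices_subset hC hosc h.superset ht)

variable [LocallyCompactSpace T] [SecondCountableTopology T] [MeasurableSpace C(T, ℝ)]
  [BorelSpace C(T, ℝ)] {Ω : Type*} [MeasurableSpace Ω] {P : Measure Ω}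
  {R : Ω → Set C(T, ℝ)} {X : Ω → C(T, ℝ)} {Ω' : ℕ → Type*} [∀ n, MeasurableSpace (Ω' n)]
  {P' : ∀ n, Measure (Ω' n)} {R' : ∀ n, Ω' n → Set C(T, ℝ)} {X' : ∀ n, Ω' n → C(T, ℝ)}

lemma measure_tube_subset_le_liminf [IsFiniteMeasure P] [∀ n, IsFiniteMeasure (P' n)]
    (hK : IsCompact K) (hη : 0 < η) (hR : IsRandomSet R) (hR' : ∀ n, IsRandomSet (R' n))
    (hfin : ∀ᵐ ω ∂P, HasFiniteExceedances (R ω))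
    (hvoid : ∀ D ⊆ exceedSet K η, MeasurableSet D →
      Tendsto (fun n => P' n {ω | Disjoint (R' n ω) D}) atTop (𝓝 (P {ω | Disjoint (R ω) D})))
    (hX : ∀ᵐ ω ∂P, IsEnvelope (X ω) (R ω)) (hX' : ∀ n, ∀ᵐ ω ∂P' n, IsEnvelope (X' n ω) (R' n ω))
    (G : Set C(T, ℝ)) :
    P {ω | tube K η (X ω) ⊆ G} ≤ liminf (fun n => P' n (X' n ⁻¹' G)) atTop := by
  obtain ⟨C, hC, hC_disj, hC_union, hosc⟩ := exists_measurable_partition_exceedSet hK η hη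
  let 𝒜 : Set (Set ℕ) := {A | ∃ f Q, IsEnvelope f Q ∧ tube K η f ⊆ G ∧ hitIndices C Q = A}
  have h_hit_fin : ∀ᵐ ω ∂P, (hitIndices C (R ω)).Finite := by
    filter_upwards [hfin] with ω hω
    exact finite_hitIndices hC_disj (hC_union ▸ hω K hK η hη)
  calc P {ω | tube K η (X ω) ⊆ G} ≤ P {ω | hitIndices C (R ω) ∈ 𝒜} := by
        refine measure_mono_ae ?_
        filter_upwards [hX] with ω hω hωG
        exact ⟨X ω, R ω, hω, hωG, rfl⟩
    _ ≤ liminf (fun n => P' n {ω | hitIndices C (R' n ω) ∈ 𝒜}) atTop :=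
        measure_hitIndices_mem_le_liminf hR hR' hvoid hC
          (fun j => hC_union ▸ subset_iUnion C j) h_hit_fin 𝒜
    _ ≤ liminf (fun n => P' n (X' n ⁻¹' G)) atTop := by
        refine liminf_le_liminf (Eventually.of_forall fun n => measure_mono_ae ?_)
        filter_upwards [hX' n] with ω hω ⟨f, Q, hfQ, hfG, hQ⟩
        exact hfG (hω.mem_tube_of_hitIndices_eq hfQ hη.le hC_union.superset hosc hQ.symm)

lemma measure_preimage_open_le_liminf [IsFiniteMeasure P] [∀ n, IsFiniteMeasure (P' n)]
    (hR : IsRandomSet R) (hR' : ∀ n, IsRandomSet (R' n))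
    (hfin : ∀ᵐ ω ∂P, HasFiniteExceedances (R ω))
    (hvoid : ∀ K, IsCompact K → ∀ η > 0, ∀ D ⊆ exceedSet K η, MeasurableSet D →
      Tendsto (fun n => P' n {ω | Disjoint (R' n ω) D}) atTop (𝓝 (P {ω | Disjoint (R ω) D})))
    (hX : ∀ᵐ ω ∂P, IsEnvelope (X ω) (R ω)) (hX' : ∀ n, ∀ᵐ ω ∂P' n, IsEnvelope (X' n ω) (R' n ω))
    {G : Set C(T, ℝ)} (hG : IsOpen G) :
    P (X ⁻¹' G) ≤ liminf (fun n => P' n (X' n ⁻¹' G)) atTop := by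
  let E := CompactExhaustion.choice T
  have h_union : X ⁻¹' G = ⋃ m : ℕ, {ω | tube (E m) (1 / ((m : ℝ) + 1)) (X ω) ⊆ G} := by
    ext ω
    rw [mem_iUnion]
    exact ⟨fun h => exists_tube_subset E hG h, fun ⟨m, hm⟩ =>
      hm (mem_tube_self _ Nat.one_div_pos_of_nat.le _)⟩
  have h_mono : Monotone fun m : ℕ => {ω | tube (E m) (1 / ((m : ℝ) + 1)) (X ω) ⊆ G} :=
    fun m n hmn ω => (tube_subset_tube (E.subset hmn) (Nat.one_div_le_one_div hmn) (X ω)).trans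
  rw [h_union, h_mono.measure_iUnion]
  exact iSup_le fun m => measure_tube_subset_le_liminf (E.isCompact m) Nat.one_div_pos_of_nat
    hR hR' hfin (hvoid _ (E.isCompact m) _ Nat.one_div_pos_of_nat) hX hX' G

-- Envelopes with the same hit pattern are uniformly close, and the hit pattern is a finite random
-- set whose law is determined by the avoidance probabilities.
theorem tendstoInDistribution_of_tendsto_avoidance [IsProbabilityMeasure P]
    [∀ n, IsProbabilityMeasure (P' n)] (hR : IsRandomSet R) (hR' : ∀ n, IsRandomSet (R' n))
    (hfin : ∀ᵐ ω ∂P, HasFiniteExceedances (R ω))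
    (hvoid : ∀ K, IsCompact K → ∀ η > 0, ∀ D ⊆ exceedSet K η, MeasurableSet D →
      Tendsto (fun n => P' n {ω | Disjoint (R' n ω) D}) atTop (𝓝 (P {ω | Disjoint (R ω) D})))
    (hX_meas : AEMeasurable X P) (hX'_meas : ∀ n, AEMeasurable (X' n) (P' n))
    (hX : ∀ᵐ ω ∂P, IsEnvelope (X ω) (R ω))
    (hX' : ∀ n, ∀ᵐ ω ∂P' n, IsEnvelope (X' n ω) (R' n ω)) :
    TendstoInDistribution X' atTop X P' P where
  forall_aemeasurable := hX'_meas
  aemeasurable_limit := hX_meas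
  tendsto := by
    refine tendsto_of_forall_isOpen_le_liminf' fun G hG => ?_
    simp only [ProbabilityMeasure.coe_mk,
      Measure.map_apply_of_aemeasurable hX_meas hG.measurableSet,
      Measure.map_apply_of_aemeasurable (hX'_meas _) hG.measurableSet]
    exact measure_preimage_open_le_liminf hR hR' hfin hvoid hX hX' hG

end WeakConvergence

section Severity

/-- The severity measure `u⁻² du` on `(0, ∞)`. -/
def severity : Measure ℝ :=
  ((volume : Measure ℝ).restrict (Ioi 0)).withDensity fun u => ENNReal.ofReal (u ^ 2)⁻¹

instance : SFinite severity := by unfold severity; infer_instance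

lemma ae_severity_pos : ∀ᵐ u ∂severity, 0 < u :=
  (withDensity_absolutelyContinuous _ _).ae_le (ae_restrict_mem measurableSet_Ioi)

lemma severity_Ioi {a : ℝ} (ha : 0 < a) : severity (Ioi a) = ENNReal.ofReal a⁻¹ := by
  have h_rpow : EqOn (fun u : ℝ => u ^ (-2 : ℝ)) (fun u => (u ^ 2)⁻¹) (Ioi a) := fun u hu => by
    change u ^ (-2 : ℝ) = (u ^ 2)⁻¹
    rw [Real.rpow_neg (ha.trans hu).le, Real.rpow_two]
  have h_integral : ∫ u in Ioi a, (u ^ 2)⁻¹ = a⁻¹ := by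
    rw [← setIntegral_congr_fun measurableSet_Ioi h_rpow,
      integral_Ioi_rpow_of_lt (by norm_num) ha, show (-2 : ℝ) + 1 = -1 by norm_num,
      Real.rpow_neg_one, neg_div_neg_eq, div_one]
  have h_integrable : IntegrableOn (fun u : ℝ => (u ^ 2)⁻¹) (Ioi a) :=
    (integrableOn_Ioi_rpow_of_lt (by norm_num) ha).congr_fun h_rpow measurableSet_Ioi
  rw [severity, withDensity_apply _ measurableSet_Ioi, Measure.restrict_restrict measurableSet_Ioi,
    inter_eq_left.2 (Ioi_subset_Ioi ha.le), ← h_integral,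
    ofReal_integral_eq_lintegral_ofReal h_integrable (ae_of_all _ fun u => by positivity)]

lemma severity_setOf_lt_mul_le {η : ℝ} (hη : 0 < η) (M : ℝ≥0∞) :
    severity {u | ENNReal.ofReal η < ENNReal.ofReal u * M} ≤ M / ENNReal.ofReal η := by
  rcases eq_or_ne M ∞ with rfl | hM
  · rw [ENNReal.top_div_of_ne_top ENNReal.ofReal_ne_top]
    exact le_top
  lift M to ℝ≥0 using hM
  rcases eq_or_ne M 0 with rfl | hM
  · simp
  have hM_pos : (0 : ℝ) < M := by positivity
  have h_eq : {u : ℝ | ENNReal.ofReal η < ENNReal.ofReal u * M} = Ioi (η / M) := by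
    ext u
    rw [mem_ofPred_eq, ← ENNReal.ofReal_coe_nnreal, ← ENNReal.ofReal_mul' M.coe_nonneg,
      ENNReal.ofReal_lt_ofReal_iff', mem_Ioi, div_lt_iff₀ hM_pos]
    exact ⟨And.left, fun h => ⟨h, hη.trans h⟩⟩
  rw [h_eq, severity_Ioi (by positivity), inv_div, ENNReal.ofReal_div_of_pos hη,
    ENNReal.ofReal_coe_nnreal]

lemma map_mul_left_severity {c : ℝ} (hc : 0 < c) :
    severity.map (c * ·) = ENNReal.ofReal c • severity := by
  let density : ℝ → ℝ≥0∞ := (Ioi 0).indicator fun u => ENNReal.ofReal (u ^ 2)⁻¹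
  have h_meas : Measurable density := Measurable.indicator (by fun_prop) measurableSet_Ioi
  have h_severity : severity = volume.withDensity density := by
    rw [severity, ← withDensity_indicator measurableSet_Ioi]
  have h_density (u : ℝ) : density u = ENNReal.ofReal (c ^ 2) * density (c * u) := by
    rcases le_or_gt u 0 with hu | hu
    · simp [density, hu, hc]
    · have hcu : 0 < c * u := mul_pos hc hu
      simp only [density, indicator_of_mem (mem_Ioi.2 hu), indicator_of_mem (mem_Ioi.2 hcu)]
      rw [← ENNReal.ofReal_mul (by positivity)]
      congr 1
      field_simp
  have h_const : ENNReal.ofReal (c ^ 2) * ENNReal.ofReal |c⁻¹| = ENNReal.ofReal c := by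
    rw [abs_of_pos (inv_pos.2 hc), ← ENNReal.ofReal_mul (by positivity)]
    congr 1
    field_simp
  ext A hA
  rw [Measure.map_apply (measurable_const_mul c) hA, Measure.smul_apply, smul_eq_mul, h_severity,
    withDensity_apply _ (measurable_const_mul c hA), withDensity_apply _ hA]
  calc ∫⁻ u in (c * ·) ⁻¹' A, density u
      = ENNReal.ofReal (c ^ 2) * ∫⁻ u in (c * ·) ⁻¹' A, density (c * u) := by
        rw [← lintegral_const_mul' _ _ ENNReal.ofReal_ne_top]
        exact lintegral_congr h_density
    _ = ENNReal.ofReal (c ^ 2) * (ENNReal.ofReal |c⁻¹| * ∫⁻ u in A, density u) := by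
        rw [← setLIntegral_map hA h_meas (measurable_const_mul c), Real.map_volume_mul_left hc.ne',
          Measure.restrict_smul, lintegral_smul_measure, smul_eq_mul]
    _ = ENNReal.ofReal c * ∫⁻ u in A, density u := by rw [← mul_assoc, h_const]

end Severity

section StormIntensity

variable {d : ℕ}

/-- The storm `t ↦ u x(t - s)` of a mark `(s, u, x)`. -/
def stormShape (z : Mark d) : Path d :=
  ⟨fun t => z.2.1 * z.2.2 (t - z.1), by fun_prop⟩

/-- The measure `ds × u⁻² du × P_X(dx)`. -/
def baseIntensity (PX : Measure (Path d)) : Measure (Mark d) :=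
  (volume : Measure (Space d)).prod (severity.prod PX)

/-- Multiplication of the severity of a mark by `c`. -/
def scaleMark (c : ℝ) : Mark d → Mark d := Prod.map id (Prod.map (c * ·) id)

variable {PX : Measure (Path d)} {K : Set (Space d)} {η c : ℝ} {D : Set (Mark d)}

lemma continuous_stormShape : Continuous (stormShape (d := d)) := by
  refine ContinuousMap.continuous_of_continuous_uncurry _ ?_
  change Continuous fun p : Mark d × Space d => p.1.2.1 * p.1.2.2 (p.2 - p.1.1)
  fun_prop

lemma stormShape_scaleMark (c : ℝ) (z : Mark d) : stormShape (scaleMark c z) = c • stormShape z :=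
  ContinuousMap.ext fun _ => mul_assoc _ _ _

lemma measurable_scaleMark (c : ℝ) : Measurable (scaleMark (d := d) c) :=
  measurable_id.prodMap ((measurable_const_mul c).prodMap measurable_id)

variable [SFinite PX]

instance : SFinite (baseIntensity PX) := by unfold baseIntensity; infer_instance

lemma stormIntensity_preimage_scaleMark (μ : ℝ) (ψ : Space d → ℝ) (hc : 0 < c)
    (hD : MeasurableSet D) :
    stormIntensity μ ψ PX (scaleMark c ⁻¹' D) = ENNReal.ofReal c * stormIntensity μ ψ PX D := by
  have h_map : (stormIntensity μ ψ PX).map (scaleMark c) =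
      ENNReal.ofReal c • stormIntensity μ ψ PX := by
    change (ENNReal.ofReal μ⁻¹ • (Measure.prod _ (severity.prod PX))).map _ =
      _ • ENNReal.ofReal μ⁻¹ • (Measure.prod _ (severity.prod PX))
    rw [Measure.map_smul, scaleMark, ← Measure.map_prod_map _ _ measurable_id
        ((measurable_const_mul c).prodMap measurable_id),
      ← Measure.map_prod_map _ _ (measurable_const_mul c) measurable_id, map_mul_left_severity hc,
      Measure.map_id, Measure.map_id, Measure.prod_smul_left, Measure.prod_smul_right, smul_comm]
  rw [← Measure.map_apply (measurable_scaleMark c) hD, h_map, Measure.smul_apply, smul_eq_mul]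

lemma stormIntensity_stormShape_preimage_smul (μ : ℝ) (ψ : Space d → ℝ) (hc : 0 < c)
    {D : Set (Path d)} (hD : MeasurableSet D) :
    stormIntensity μ ψ PX (stormShape ⁻¹' ((c • ·) ⁻¹' D)) =
      ENNReal.ofReal c * stormIntensity μ ψ PX (stormShape ⁻¹' D) := by
  have h_scale : stormShape ⁻¹' ((c • ·) ⁻¹' D) = scaleMark c ⁻¹' (stormShape ⁻¹' D) := by
    ext z
    simp only [mem_preimage, stormShape_scaleMark]
  rw [h_scale, stormIntensity_preimage_scaleMark μ ψ hc (continuous_stormShape.measurable hD)]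

lemma stormIntensity_apply (μ : ℝ) {ψ : Space d → ℝ} (hψ : Measurable ψ) (hD : MeasurableSet D) :
    stormIntensity μ ψ PX D =
      ENNReal.ofReal μ⁻¹ * ∫⁻ z in D, ENNReal.ofReal (ψ z.1) ∂baseIntensity PX := by
  change (ENNReal.ofReal μ⁻¹ • (Measure.prod _ (severity.prod PX))) D = _
  rw [Measure.smul_apply, prod_withDensity_left hψ.ennreal_ofReal, withDensity_apply _ hD]
  rfl

lemma stormIntensity_one (μ : ℝ) (hD : MeasurableSet D) :
    stormIntensity μ (fun _ => 1) PX D = ENNReal.ofReal μ⁻¹ * baseIntensity PX D := by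
  simp only [stormIntensity_apply μ measurable_const hD, ENNReal.ofReal_one, setLIntegral_one]

lemma severity_exceed_le (hη : 0 < η) (K : Set (Space d)) (s : Space d) (x : Path d) :
    severity {u | stormShape (s, u, x) ∈ exceedSet K η} ≤
      (⨆ t ∈ K, ENNReal.ofReal (x (t - s))) / ENNReal.ofReal η := by
  refine (measure_mono_ae ?_).trans (severity_setOf_lt_mul_le hη _)
  filter_upwards [ae_severity_pos] with u hu ⟨t, ht, hut⟩
  calc ENNReal.ofReal η < ENNReal.ofReal (u * x (t - s)) :=
        (ENNReal.ofReal_lt_ofReal_iff (hη.trans hut)).2 hut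
    _ = ENNReal.ofReal u * ENNReal.ofReal (x (t - s)) := ENNReal.ofReal_mul hu.le
    _ ≤ _ := by
        gcongr
        exact le_iSup₂ (f := fun t (_ : t ∈ K) => ENNReal.ofReal (x (t - s))) t ht

lemma baseIntensity_apply (hD : MeasurableSet D) :
    baseIntensity PX D = ∫⁻ x, ∫⁻ s, severity {u | (s, u, x) ∈ D} ∂volume ∂PX := by
  have h_assoc : MeasurableSet (MeasurableEquiv.prodAssoc ⁻¹' D) :=
    MeasurableEquiv.prodAssoc.measurable hD
  rw [baseIntensity, ← Measure.prodAssoc_prod,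
    Measure.map_apply MeasurableEquiv.prodAssoc.measurable hD, Measure.prod_apply_symm h_assoc]
  exact lintegral_congr fun x => Measure.prod_apply (measurable_prodMk_right h_assoc)

lemma baseIntensity_exceed_lt_top (hX : StormIntegrable PX) (hK : IsCompact K) (hη : 0 < η) :
    baseIntensity PX (stormShape ⁻¹' exceedSet K η) < ∞ := by
  have h_inv_ne_top : (ENNReal.ofReal η)⁻¹ ≠ ∞ :=
    ENNReal.inv_ne_top.2 (ENNReal.ofReal_pos.2 hη).ne'
  calc baseIntensity PX (stormShape ⁻¹' exceedSet K η)
      = ∫⁻ x, ∫⁻ s, severity {u | stormShape (s, u, x) ∈ exceedSet K η} ∂volume ∂PX :=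
        baseIntensity_apply ((isOpen_exceedSet K η).preimage continuous_stormShape).measurableSet
    _ ≤ ∫⁻ x, ∫⁻ s, (⨆ t ∈ K, ENNReal.ofReal (x (t - s))) * (ENNReal.ofReal η)⁻¹ ∂volume ∂PX :=
        lintegral_mono fun x => lintegral_mono fun s => severity_exceed_le hη K s x
    _ = (∫⁻ x, ∫⁻ s, (⨆ t ∈ K, ENNReal.ofReal (x (t - s))) ∂volume ∂PX) *
          (ENNReal.ofReal η)⁻¹ := by
        simp only [lintegral_mul_const' _ _ h_inv_ne_top]
    _ < ∞ := ENNReal.mul_lt_top (hX K hK) h_inv_ne_top.lt_top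

section Stationary

variable {Ω : Type*} [MeasurableSpace Ω] {P : Measure Ω} {Psi : Ω → Path d}

lemma IsStationary.lintegral_ofReal_eq (hstat : IsStationary Psi P) (s : Space d) :
    ∫⁻ ω, ENNReal.ofReal (Psi ω s) ∂P = ∫⁻ ω, ENNReal.ofReal (Psi ω 0) ∂P := by
  have h := (hstat s 1 fun _ => 0).comp
    (u := fun v : Fin 1 → ℝ => ENNReal.ofReal (v 0)) (by fun_prop)
  simpa [Function.comp_def] using h.lintegral_eq

lemma IsStationary.lintegral_stormIntensity [SFinite P] (hstat : IsStationary Psi P)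
    (hPsi : Measurable Psi) (μ : ℝ) (hD : MeasurableSet D) :
    ∫⁻ ω, stormIntensity μ (Psi ω) PX D ∂P =
      ENNReal.ofReal μ⁻¹ * ((∫⁻ ω, ENNReal.ofReal (Psi ω 0) ∂P) * baseIntensity PX D) := by
  have h_eval : Measurable fun q : Path d × Space d => q.1 q.2 :=
    (by fun_prop : Continuous fun q : Path d × Space d => q.1 q.2).measurable
  have h_meas : Measurable fun q : Ω × Mark d => ENNReal.ofReal (Psi q.1 q.2.1) :=
    (h_eval.comp (hPsi.prodMap measurable_fst)).ennreal_ofReal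
  simp only [fun ω => stormIntensity_apply μ (PX := PX) (Psi ω).continuous.measurable hD]
  rw [lintegral_const_mul _ h_meas.lintegral_prod_right',
    lintegral_lintegral_swap h_meas.aemeasurable]
  simp only [hstat.lintegral_ofReal_eq, setLIntegral_const]

end Stationary

end StormIntensity

section PointProcess

variable {Ω S : Type*} [MeasurableSpace Ω] [MeasurableSpace S] {P : Measure Ω}
  {N Lam : Ω → Measure S} {p : ℕ → Ω → S} {D : Set S}

lemma IsPoissonProcess.measureReal_count_eq {lam : Measure S} (h : IsPoissonProcess N lam P)
    (hD : MeasurableSet D) (hfin : lam D < ∞) (m : ℕ) :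
    P.real {ω | N ω D = m} =
      Real.exp (-(lam D).toReal) * (lam D).toReal ^ m / (m ! : ℝ) := by
  have h_meas : Measurable fun ω => N ω D :=
    (Measure.measurable_coe hD).comp h.measurable_process
  have h_cast : (Nat.cast : ℕ → ℝ≥0∞) ⁻¹' {(m : ℝ≥0∞)} = {m} := by ext k; simp
  calc P.real {ω | N ω D = m}
      = (P.map fun ω => N ω D).real {(m : ℝ≥0∞)} :=
        (map_measureReal_apply h_meas (measurableSet_singleton _)).symm
    _ = (poissonMeasure (lam D).toNNReal).real {m} := by
        rw [h.law_count D hD hfin,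
          map_measureReal_apply measurable_from_top (measurableSet_singleton _), h_cast]
    _ = Real.exp (-(lam D).toReal) * (lam D).toReal ^ m / (m ! : ℝ) :=
        poissonMeasure_real_singleton _ _

lemma IsPoissonProcess.isCoxProcess [IsProbabilityMeasure P] {lam : Measure S}
    (h : IsPoissonProcess N lam P) : IsCoxProcess N (fun _ => lam) P where
  measurable_process := h.measurable_process
  measurable_directing := measurable_const
  cond_count k B hB hdisj m := by
    have h_meas (j : Fin k) : MeasurableSet {ω | N ω (B j) = m j} :=
      ((Measure.measurable_coe (hB j)).comp h.measurable_process) (measurableSet_singleton _)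
    have h_inter : {ω | ∀ j, N ω (B j) = m j} = ⋂ j, {ω | N ω (B j) = m j} := by
      ext ω; simp
    have h_indep : P (⋂ j, {ω | N ω (B j) = m j}) = ∏ j, P {ω | N ω (B j) = m j} := by
      have h_mul := (h.indep_count k B hB hdisj).measure_inter_preimage_eq_mul Finset.univ
        (sets := fun j => {(m j : ℝ≥0∞)}) fun j _ => measurableSet_singleton _
      simp only [Finset.mem_univ, iInter_true] at h_mul
      exact h_mul
    rw [MeasurableSpace.comap_const, condExp_bot]
    refine ae_of_all _ fun _ hfin => ?_
    rw [h_inter, integral_indicator_const _ (MeasurableSet.iInter h_meas), smul_eq_mul, mul_one,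
      measureReal_def, h_indep, ENNReal.toReal_prod]
    exact Finset.prod_congr rfl fun j _ => h.measureReal_count_eq (hB j) (hfin j) (m j)

lemma IsCoxProcess.measurableSet_count_eq (h : IsCoxProcess N Lam P) (hD : MeasurableSet D)
    (m : ℕ) : MeasurableSet {ω | N ω D = m} :=
  ((Measure.measurable_coe hD).comp h.measurable_process) (measurableSet_singleton _)

variable [IsProbabilityMeasure P]

lemma IsCoxProcess.measure_count_eq (h : IsCoxProcess N Lam P) (hD : MeasurableSet D)
    (hfin : ∀ᵐ ω ∂P, Lam ω D < ∞) (m : ℕ) :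
    P {ω | N ω D = m} = ∫⁻ ω, poissonMeasure (Lam ω D).toNNReal {m} ∂P := by
  have h_meas : Measurable fun ω => Lam ω D :=
    (Measure.measurable_coe hD).comp h.measurable_directing
  have h_cond := h.cond_count 1 (fun _ => D) (fun _ => hD)
    (fun i j hij => absurd (Subsingleton.elim i j) hij) (fun _ => m)
  simp only [forall_const, Finset.univ_unique, Finset.prod_const, Finset.card_singleton,
    pow_one] at h_cond
  have h_real : P.real {ω | N ω D = m} =
      ∫ ω, (poissonMeasure (Lam ω D).toNNReal).real {m} ∂P := by
    rw [← integral_condExp_indicator h.measurable_directing (h.measurableSet_count_eq hD m)]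
    refine integral_congr_ae ?_
    filter_upwards [h_cond, hfin] with ω hω hωD
    rw [hω hωD, poissonMeasure_real_singleton, ENNReal.coe_toNNReal_eq_toReal]
  rw [← ofReal_measureReal, h_real, ofReal_integral_eq_lintegral_ofReal ?_
    (ae_of_all _ fun _ => measureReal_nonneg)]
  · exact lintegral_congr fun ω => ofReal_measureReal
  · refine Integrable.of_bound ?_ 1 (ae_of_all _ fun ω => ?_)
    · simp only [poissonMeasure_real_singleton]
      exact Measurable.aestronglyMeasurable (by fun_prop)
    · rw [Real.norm_of_nonneg measureReal_nonneg]
      exact measureReal_le_one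

lemma IsCoxProcess.ae_count_lt_top (h : IsCoxProcess N Lam P) (hD : MeasurableSet D)
    (hfin : ∀ᵐ ω ∂P, Lam ω D < ∞) : ∀ᵐ ω ∂P, N ω D < ∞ := by
  have h_meas : Measurable fun ω => Lam ω D :=
    (Measure.measurable_coe hD).comp h.measurable_directing
  have h_disj : Pairwise (Function.onFun Disjoint fun m : ℕ => {ω | N ω D = m}) :=
    fun m m' hm => disjoint_left.2 fun ω hω hω' =>
      hm (Nat.cast_injective (R := ℝ≥0∞) (hω.symm.trans hω'))
  have h_sum : P (⋃ m : ℕ, {ω | N ω D = m}) = 1 := by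
    rw [measure_iUnion h_disj (h.measurableSet_count_eq hD)]
    simp only [h.measure_count_eq hD hfin]
    rw [← lintegral_tsum]
    · have h_total (r : ℝ≥0) : ∑' m, poissonMeasure r {m} = 1 := by
        simpa using (poissonMeasure r).tsum_indicator_apply_singleton univ MeasurableSet.univ
      simp only [h_total, lintegral_one, measure_univ]
    · intro m
      simp only [poissonMeasure_singleton]
      exact Measurable.aemeasurable (by fun_prop)
  have h_ae : ∀ᵐ ω ∂P, ω ∈ ⋃ m : ℕ, {ω | N ω D = m} :=
    mem_ae_iff_prob_eq_one (MeasurableSet.iUnion (h.measurableSet_count_eq hD)) |>.2 h_sum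
  filter_upwards [h_ae] with ω hω
  obtain ⟨m, hm⟩ := mem_iUnion.1 hω
  exact hm.trans_lt (ENNReal.natCast_lt_top m)

end PointProcess

section PointMeasure

variable {Ω S : Type*} [MeasurableSpace S] {p : ℕ → Ω → S} {D : Set S}

lemma pointMeasure_apply (ω : Ω) (hD : MeasurableSet D) :
    pointMeasure p ω D = Measure.count {i | p i ω ∈ D} := by
  rw [pointMeasure, Measure.count, Measure.sum_apply _ hD, Measure.sum_apply _ .of_discrete]
  exact tsum_congr fun i => by
    rw [Measure.dirac_apply' _ hD, Measure.dirac_apply' _ .of_discrete]; rfl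

lemma pointMeasure_eq_zero_iff {ω : Ω} (hD : MeasurableSet D) :
    pointMeasure p ω D = 0 ↔ Disjoint (range fun i => p i ω) D := by
  rw [pointMeasure_apply ω hD, Measure.count_eq_zero_iff, disjoint_left, forall_mem_range,
    eq_empty_iff_forall_notMem]
  rfl

lemma finite_range_inter_of_pointMeasure_lt_top {ω : Ω} (hD : MeasurableSet D)
    (h : pointMeasure p ω D < ∞) : ((range fun i => p i ω) ∩ D).Finite := by
  rw [pointMeasure_apply ω hD, Measure.count_apply_lt_top] at h
  refine (h.image fun i => p i ω).subset ?_
  rintro _ ⟨⟨i, rfl⟩, hi⟩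
  exact ⟨i, hi, rfl⟩

variable [MeasurableSpace Ω]

lemma isRandomSet_range (hp : ∀ i, Measurable (p i)) : IsRandomSet fun ω => range fun i => p i ω :=
  fun D hD => by
    have h_inter : {ω | Disjoint (range fun i => p i ω) D} = ⋂ i, p i ⁻¹' Dᶜ := by
      ext ω
      simp [disjoint_left]
    rw [h_inter]
    exact MeasurableSet.iInter fun i => hp i hD.compl

lemma IsCoxProcess.measure_disjoint_range {Lam : Ω → Measure S} {P : Measure Ω}
    [IsProbabilityMeasure P] (h : IsCoxProcess (pointMeasure p) Lam P) (hD : MeasurableSet D)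
    (hfin : ∀ᵐ ω ∂P, Lam ω D < ∞) :
    P {ω | Disjoint (range fun i => p i ω) D} =
      ∫⁻ ω, ENNReal.ofReal (Real.exp (-(Lam ω D).toReal)) ∂P := by
  have h_void := h.measure_count_eq hD hfin 0
  simp only [Nat.cast_zero, pointMeasure_eq_zero_iff hD, poissonMeasure_singleton, pow_zero,
    mul_one, Nat.factorial_zero, Nat.cast_one, div_one, ENNReal.coe_toNNReal_eq_toReal] at h_void
  exact h_void

end PointMeasure

section LaplaceTransform

lemma abs_mul_exp_neg_div_sub_one_le {x : ℝ} (hx : 0 ≤ x) (n : ℕ) :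
    |(n : ℝ) * (Real.exp (-(x / n)) - 1)| ≤ x := by
  rcases n.eq_zero_or_pos with rfl | hn
  · simpa using hx
  have hn' : (0 : ℝ) < n := Nat.cast_pos.2 hn
  have h_exp_le : Real.exp (-(x / n)) ≤ 1 :=
    Real.exp_le_one_iff.2 (neg_nonpos.2 (by positivity))
  have h_le_exp : 1 - x / n ≤ Real.exp (-(x / n)) := Real.one_sub_le_exp_neg _
  calc |(n : ℝ) * (Real.exp (-(x / n)) - 1)| = n * (1 - Real.exp (-(x / n))) := by
        rw [abs_mul, abs_of_pos hn', abs_of_nonpos (sub_nonpos.2 h_exp_le), neg_sub]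
    _ ≤ n * (x / n) := by gcongr; linarith
    _ = x := mul_div_cancel₀ x hn'.ne'

lemma tendsto_mul_exp_neg_div_sub_one (x : ℝ) :
    Tendsto (fun n : ℕ => (n : ℝ) * (Real.exp (-(x / n)) - 1)) atTop (𝓝 (-x)) := by
  have h_deriv : HasDerivAt (fun s : ℝ => Real.exp (-(s * x))) (-x) 0 := by
    simpa using (((hasDerivAt_id (0 : ℝ)).mul_const x).neg).exp
  have h_inv : Tendsto (fun n : ℕ => (n : ℝ)⁻¹) atTop (𝓝[≠] 0) :=
    (tendsto_inv_atTop_nhdsGT_zero.comp tendsto_natCast_atTop_atTop).mono_right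
      (nhdsWithin_mono _ fun _ hs => ne_of_gt hs)
  refine (h_deriv.tendsto_slope_zero.comp h_inv).congr fun n => ?_
  simp [div_eq_inv_mul]

variable {Ω : Type*} [MeasurableSpace Ω] {P : Measure Ω}

lemma integrable_exp_neg [IsFiniteMeasure P] {W : Ω → ℝ} (hW : AEStronglyMeasurable W P)
    (hW0 : 0 ≤ᵐ[P] W) : Integrable (fun ω => Real.exp (-W ω)) P := by
  refine Integrable.of_bound (Real.continuous_exp.comp_aestronglyMeasurable hW.neg) 1 ?_
  filter_upwards [hW0] with ω hω
  rwa [Real.norm_eq_abs, Real.abs_exp, Real.exp_le_one_iff, neg_nonpos]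

variable [IsProbabilityMeasure P]

lemma tendsto_integral_exp_neg_div_pow {W : Ω → ℝ} (hW : Integrable W P) (hW0 : 0 ≤ᵐ[P] W) :
    Tendsto (fun n : ℕ => (∫ ω, Real.exp (-(W ω / n)) ∂P) ^ n) atTop
      (𝓝 (Real.exp (-∫ ω, W ω ∂P))) := by
  have h_integrable (n : ℕ) : Integrable (fun ω => Real.exp (-(W ω / n))) P :=
    integrable_exp_neg (hW.div_const _).aestronglyMeasurable
      (hW0.mono fun ω hω => div_nonneg hω n.cast_nonneg)
  have h_lim : Tendsto (fun n : ℕ => ∫ ω, (n : ℝ) * (Real.exp (-(W ω / n)) - 1) ∂P) atTop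
      (𝓝 (∫ ω, -W ω ∂P)) :=
    tendsto_integral_of_dominated_convergence W
      (fun n => (((h_integrable n).sub (integrable_const 1)).const_mul _).aestronglyMeasurable) hW
      (fun n => hW0.mono fun ω hω => abs_mul_exp_neg_div_sub_one_le hω n)
      (ae_of_all _ fun ω => tendsto_mul_exp_neg_div_sub_one (W ω))
  have h_slope : Tendsto (fun n : ℕ => (n : ℝ) * (∫ ω, Real.exp (-(W ω / n)) ∂P - 1)) atTop
      (𝓝 (-∫ ω, W ω ∂P)) := by
    rw [← integral_neg]
    refine h_lim.congr fun n => ?_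
    rw [integral_const_mul, integral_sub (h_integrable n) (integrable_const _)]
    simp
  simpa using Real.tendsto_one_add_pow_exp_of_tendsto h_slope

variable {S : Type*} [MeasurableSpace S] {p : ℕ → Ω → S} {Lam : Ω → Measure S} {D : Set S}

-- The superposition of `n + 1` independent copies, each thinned by the factor `c / (n + 1)`,
-- averages out the randomness of the directing measure.
lemma IsCoxProcess.tendsto_measure_disjoint_range_pow (h : IsCoxProcess (pointMeasure p) Lam P)
    (hD : MeasurableSet D) (hfin : ∫⁻ ω, Lam ω D ∂P ≠ ∞) {c : ℝ} (hc : 0 ≤ c) {Dn : ℕ → Set S}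
    (hDn : ∀ n, MeasurableSet (Dn n))
    (hLam : ∀ n ω, Lam ω (Dn n) = ENNReal.ofReal (c / ((n : ℝ) + 1)) * Lam ω D) :
    Tendsto (fun n => P {ω | Disjoint (range fun i => p i ω) (Dn n)} ^ (n + 1)) atTop
      (𝓝 (ENNReal.ofReal (Real.exp (-(ENNReal.ofReal c * ∫⁻ ω, Lam ω D ∂P).toReal)))) := by
  let W (ω : Ω) : ℝ := c * (Lam ω D).toReal
  have h_meas : Measurable fun ω => Lam ω D :=
    (Measure.measurable_coe hD).comp h.measurable_directing
  have h_fin : ∀ᵐ ω ∂P, Lam ω D < ∞ := ae_lt_top h_meas hfin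
  have hW : Integrable W P :=
    (integrable_toReal_of_lintegral_ne_top h_meas.aemeasurable hfin).const_mul c
  have hW0 (ω : Ω) : 0 ≤ W ω := mul_nonneg hc ENNReal.toReal_nonneg
  have h_integral : ∫ ω, W ω ∂P = (ENNReal.ofReal c * ∫⁻ ω, Lam ω D ∂P).toReal := by
    rw [integral_const_mul, integral_toReal h_meas.aemeasurable h_fin, ENNReal.toReal_mul,
      ENNReal.toReal_ofReal hc]
  have h_void (n : ℕ) : P {ω | Disjoint (range fun i => p i ω) (Dn n)} =
      ENNReal.ofReal (∫ ω, Real.exp (-(W ω / (n + 1 : ℕ))) ∂P) := by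
    have h_fin_n : ∀ᵐ ω ∂P, Lam ω (Dn n) < ∞ := by
      filter_upwards [h_fin] with ω hω
      rw [hLam]
      exact ENNReal.mul_lt_top ENNReal.ofReal_lt_top hω
    have h_toReal (ω : Ω) : (Lam ω (Dn n)).toReal = W ω / (n + 1 : ℕ) := by
      rw [hLam, ENNReal.toReal_mul, ENNReal.toReal_ofReal (by positivity), Nat.cast_succ,
        div_mul_eq_mul_div]
    rw [h.measure_disjoint_range (hDn n) h_fin_n]
    simp only [h_toReal]
    refine (ofReal_integral_eq_lintegral_ofReal ?_ (ae_of_all _ fun _ => (Real.exp_pos _).le)).symm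
    exact integrable_exp_neg (hW.div_const _).aestronglyMeasurable
      (ae_of_all _ fun ω => div_nonneg (hW0 ω) (Nat.cast_nonneg _))
  rw [← h_integral]
  refine ((ENNReal.continuous_ofReal.tendsto _).comp <|
    (tendsto_integral_exp_neg_div_pow hW (ae_of_all _ hW0)).comp (tendsto_add_atTop_nat 1)).congr
      fun n => ?_
  rw [h_void, ← ENNReal.ofReal_pow (integral_nonneg fun _ => (Real.exp_pos _).le)]
  rfl

end LaplaceTransform

section FiniteExceedances

variable {T : Type*} [TopologicalSpace T]

lemma hasFiniteExceedances_of_compactExhaustion (E : CompactExhaustion T) {R : Set C(T, ℝ)}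
    (h : ∀ m : ℕ, (R ∩ exceedSet (E m) (1 / ((m : ℝ) + 1))).Finite) : HasFiniteExceedances R := by
  intro K hK η hη
  obtain ⟨m, hm⟩ := E.exists_superset_of_isCompact hK
  obtain ⟨k, hk⟩ := exists_nat_one_div_lt hη
  refine (h (max m k)).subset (inter_subset_inter_right R (exceedSet_subset_exceedSet ?_ ?_))
  · exact hm.trans (E.subset (le_max_left m k))
  · exact (Nat.one_div_le_one_div (le_max_right m k)).trans hk.le

lemma ae_hasFiniteExceedances [WeaklyLocallyCompactSpace T] [SigmaCompactSpace T] {Ω : Type*}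
    [MeasurableSpace Ω] {P : Measure Ω} {R : Ω → Set C(T, ℝ)}
    (h : ∀ K, IsCompact K → ∀ η > 0, ∀ᵐ ω ∂P, (R ω ∩ exceedSet K η).Finite) :
    ∀ᵐ ω ∂P, HasFiniteExceedances (R ω) := by
  let E := CompactExhaustion.choice T
  filter_upwards [ae_all_iff.2 fun m : ℕ => h (E m) (E.isCompact m) _ Nat.one_div_pos_of_nat]
    with ω hω
  exact hasFiniteExceedances_of_compactExhaustion E hω

end FiniteExceedances

section SamplePaths

variable {d : ℕ} {Ω : Type*} {p : ℕ → Ω → Mark d}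

lemma toPath_apply {f : Space d → ℝ≥0∞} (hf : ∀ t, f t < ∞)
    (hf' : Continuous fun t => (f t).toReal) (t : Space d) : toPath f t = (f t).toReal := by
  rw [toPath, dif_pos ⟨hf, hf'⟩]
  rfl

lemma HasFiniteExceedances.isEnvelope_toPath {R : Set (Path d)} (hR : HasFiniteExceedances R) :
    IsEnvelope (toPath (envelope R)) R := fun t => by
  rw [toPath_apply hR.envelope_lt_top hR.continuous_toReal_envelope]
  exact ⟨ENNReal.toReal_nonneg, ENNReal.ofReal_toReal (hR.envelope_lt_top t).ne⟩

/-- The random set of storms `t ↦ uᵢ xᵢ(t - sᵢ)` of the marks `pᵢ = (sᵢ, uᵢ, xᵢ)`. -/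
def storms (p : ℕ → Ω → Mark d) (ω : Ω) : Set (Path d) := range fun i => stormShape (p i ω)

lemma extremalField_eq_envelope (p : ℕ → Ω → Mark d) (ω : Ω) :
    extremalField p ω = envelope (storms p ω) := by
  ext t
  simp only [envelope, storms, iSup_range]
  rfl

lemma storms_eq_image (p : ℕ → Ω → Mark d) (ω : Ω) :
    storms p ω = stormShape '' range fun i => p i ω :=
  range_comp stormShape fun i => p i ω

lemma HasFiniteExceedances.isEnvelope_toPath_extremalField {ω : Ω}
    (h : HasFiniteExceedances (storms p ω)) :
    IsEnvelope (toPath (extremalField p ω)) (storms p ω) := by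
  rw [extremalField_eq_envelope]
  exact h.isEnvelope_toPath

lemma setOf_disjoint_storms (p : ℕ → Ω → Mark d) (D : Set (Path d)) :
    {ω | Disjoint (storms p ω) D} =
      {ω | Disjoint (range fun i => p i ω) (stormShape ⁻¹' D)} := by
  simp only [storms_eq_image, disjoint_image_left]

lemma measurableSet_stormShape_preimage_exceedSet (K : Set (Space d)) (η : ℝ) :
    MeasurableSet (stormShape ⁻¹' exceedSet K η) :=
  continuous_stormShape.measurable (isOpen_exceedSet K η).measurableSet

variable [MeasurableSpace Ω] {P : Measure Ω}

lemma aemeasurable_toPath {Y : Ω → Space d → ℝ≥0∞} (hY : ∀ t, Measurable fun ω => Y ω t)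
    (h : ∀ᵐ ω ∂P, (∀ t, Y ω t < ∞) ∧ Continuous fun t => (Y ω t).toReal) :
    AEMeasurable (fun ω => toPath (Y ω)) P := by
  obtain ⟨A, hA_ae, hA, hYA⟩ := h.exists_measurable_mem
  refine ⟨A.indicator fun ω => toPath (Y ω), measurable_of_measurable_eval fun t => ?_, ?_⟩
  · have h_eval : (fun ω => A.indicator (fun ω => toPath (Y ω)) ω t) =
        A.indicator fun ω => (Y ω t).toReal := by
      ext ω
      by_cases hω : ω ∈ A
      · simp only [indicator_of_mem hω, toPath_apply (hYA ω hω).1 (hYA ω hω).2]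
      · simp only [indicator_of_notMem hω, ContinuousMap.zero_apply]
    rw [h_eval]
    exact (hY t).ennreal_toReal.indicator hA
  · filter_upwards [hA_ae] with ω hω
    rw [indicator_of_mem hω]

lemma isRandomSet_storms (hp : ∀ i, Measurable (p i)) : IsRandomSet (storms p) :=
  isRandomSet_range fun i => continuous_stormShape.measurable.comp (hp i)

lemma finiteAndSampleContinuous_extremalField (hp : ∀ i, Measurable (p i))
    (hfin : ∀ᵐ ω ∂P, HasFiniteExceedances (storms p ω)) :
    FiniteAndSampleContinuous (extremalField p) P := by
  have h_eval (t : Space d) : Continuous fun z : Mark d => stormShape z t :=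
    (continuous_eval_const (F := Path d) t).comp continuous_stormShape
  have h_meas (t : Space d) : Measurable fun ω => extremalField p ω t :=
    Measurable.iSup fun i => ((h_eval t).measurable.comp (hp i)).ennreal_ofReal
  refine ⟨?_, aemeasurable_toPath h_meas ?_⟩ <;> filter_upwards [hfin] with ω hω <;>
    rw [extremalField_eq_envelope]
  · exact ⟨fun K hK => hω.iSup_envelope_lt_top hK, hω.continuous_toReal_envelope⟩
  · exact ⟨hω.envelope_lt_top, hω.continuous_toReal_envelope⟩

lemma IsCoxProcess.ae_hasFiniteExceedances_storms [IsProbabilityMeasure P]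
    {Lam : Ω → Measure (Mark d)} (h : IsCoxProcess (pointMeasure p) Lam P)
    (hLam : ∀ K, IsCompact K → ∀ η > 0,
      ∀ᵐ ω ∂P, Lam ω (stormShape ⁻¹' exceedSet K η) < ∞) :
    ∀ᵐ ω ∂P, HasFiniteExceedances (storms p ω) := by
  refine ae_hasFiniteExceedances fun K hK η hη => ?_
  have h_meas := measurableSet_stormShape_preimage_exceedSet (d := d) K η
  filter_upwards [h.ae_count_lt_top h_meas (hLam K hK η hη)] with ω hω
  rw [storms_eq_image, ← image_inter_preimage]
  exact (finite_range_inter_of_pointMeasure_lt_top h_meas hω).image stormShape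

end SamplePaths

section IIDCopies

lemma tendstoInDistribution_of_identDistrib_left {ι E Ω₀ : Type*} {Ω Ω' : ι → Type*}
    [TopologicalSpace E] [MeasurableSpace E] [OpensMeasurableSpace E] [MeasurableSpace Ω₀]
    [∀ i, MeasurableSpace (Ω i)] [∀ i, MeasurableSpace (Ω' i)] {l : Filter ι}
    {P : ∀ i, Measure (Ω i)} [∀ i, IsProbabilityMeasure (P i)] {P' : ∀ i, Measure (Ω' i)}
    [∀ i, IsProbabilityMeasure (P' i)] {P₀ : Measure Ω₀} [IsProbabilityMeasure P₀]
    {X : ∀ i, Ω i → E} {X' : ∀ i, Ω' i → E} {Z : Ω₀ → E}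
    (hX : TendstoInDistribution X l Z P P₀) (h : ∀ i, IdentDistrib (X' i) (X i) (P' i) (P i)) :
    TendstoInDistribution X' l Z P' P₀ :=
  ⟨fun i => (h i).aemeasurable_fst, hX.aemeasurable_limit,
    hX.tendsto.congr fun i => Subtype.ext (h i).map_eq.symm⟩

variable {d : ℕ} {Ω Ω₁ Ω₂ : Type*} [MeasurableSpace Ω] [MeasurableSpace Ω₁] [MeasurableSpace Ω₂]
  {P : Measure Ω} {P₁ : Measure Ω₁} {P₂ : Measure Ω₂} {Y : Ω → Path d}

lemma areIIDCopies_infinitePi [IsProbabilityMeasure P] (hY : AEMeasurable Y P) :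
    AreIIDCopies (fun i (ω : ℕ → Ω) => Y (ω i)) (Measure.infinitePi fun _ => P) Y P := by
  have h_eval (i : ℕ) := measurePreserving_eval_infinitePi (fun _ : ℕ => P) i
  have h_indep : iIndepFun (fun i (ω : ℕ → Ω) => ω i) (Measure.infinitePi fun _ => P) :=
    iIndepFun_infinitePi (X := fun _ ω => ω) fun _ => measurable_id
  refine ⟨h_indep.comp₀ (fun _ => Y) (fun i => (measurable_pi_apply i).aemeasurable)
    fun i => (h_eval i).map_eq.symm ▸ hY, fun i => ?_⟩
  exact IdentDistrib.comp_of_aemeasurable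
    ⟨(measurable_pi_apply i).aemeasurable, aemeasurable_id,
      (h_eval i).map_eq.trans Measure.map_id.symm⟩
    ((h_eval i).map_eq.symm ▸ hY)

lemma measurable_sup'_range_apply (n : ℕ) :
    Measurable fun v : ℕ → Path d =>
      (Finset.range (n + 1)).sup' Finset.nonempty_range_add_one v := by
  refine measurable_of_measurable_eval fun t => ?_
  simp only [ContinuousMap.sup'_apply]
  have h_eval (i : ℕ) : Measurable fun v : ℕ → Path d => v i t :=
    (continuous_eval_const (F := Path d) t).measurable.comp (measurable_pi_apply i)
  exact Finset.measurable_range_sup'' fun i _ => h_eval i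

lemma AreIIDCopies.identDistrib_maxFirst {Y₁ : ℕ → Ω₁ → Path d} {Y₂ : ℕ → Ω₂ → Path d}
    (h₁ : AreIIDCopies Y₁ P₁ Y P) (h₂ : AreIIDCopies Y₂ P₂ Y P) (n : ℕ) :
    IdentDistrib (maxFirst Y₁ n) (maxFirst Y₂ n) P₁ P₂ :=
  (IdentDistrib.pi (fun i => (h₁.2 i).trans (h₂.2 i).symm) h₁.1 h₂.1).comp
    (measurable_sup'_range_apply n)

end IIDCopies

section Superposition

variable {d : ℕ} {Ω : Type*} {R : Ω → Set (Path d)}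

lemma setOf_disjoint_biUnion_smul (R : Ω → Set (Path d)) (a : ℝ) (s : Finset ℕ)
    (D : Set (Path d)) :
    {ω : ℕ → Ω | Disjoint (⋃ i ∈ s, a • R (ω i)) D} =
      (s : Set ℕ).pi fun _ => {ω | Disjoint (R ω) ((a • ·) ⁻¹' D)} := by
  ext ω
  simp only [mem_ofPred_eq, disjoint_iUnion_left, Set.mem_pi, Finset.mem_coe, ← image_smul,
    disjoint_image_left]

variable [MeasurableSpace Ω]

lemma measurableSet_preimage_smul (a : ℝ) {D : Set (Path d)} (hD : MeasurableSet D) :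
    MeasurableSet ((a • ·) ⁻¹' D) :=
  (continuous_const_smul a).measurable hD

lemma IsRandomSet.biUnion_smul_eval (hR : IsRandomSet R) (a : ℝ) (s : Finset ℕ) :
    IsRandomSet fun ω : ℕ → Ω => ⋃ i ∈ s, a • R (ω i) := fun D hD => by
  rw [setOf_disjoint_biUnion_smul]
  exact MeasurableSet.pi s.countable_toSet fun _ _ => hR _ (measurableSet_preimage_smul a hD)

lemma IsRandomSet.infinitePi_disjoint_biUnion_smul {P : Measure Ω} [IsProbabilityMeasure P]
    (hR : IsRandomSet R) (a : ℝ) (s : Finset ℕ) {D : Set (Path d)} (hD : MeasurableSet D) :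
    Measure.infinitePi (fun _ : ℕ => P) {ω | Disjoint (⋃ i ∈ s, a • R (ω i)) D} =
      P {ω | Disjoint (R ω) ((a • ·) ⁻¹' D)} ^ s.card := by
  rw [setOf_disjoint_biUnion_smul,
    Measure.infinitePi_pi _ fun _ _ => hR _ (measurableSet_preimage_smul a hD),
    Finset.prod_const]

end Superposition

section Attraction

lemma integral_pos_of_frequently_pos {Ω : Type*} [MeasurableSpace Ω] {P : Measure Ω} {f : Ω → ℝ}
    (hf : Integrable f P) (hf_nonneg : 0 ≤ᵐ[P] f) (hf_pos : ∃ᵐ ω ∂P, 0 < f ω) :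
    0 < ∫ ω, f ω ∂P := by
  refine (integral_nonneg_of_ae hf_nonneg).lt_of_ne' fun h => ?_
  have h_zero := (integral_eq_zero_iff_of_nonneg_ae hf_nonneg hf).1 h
  obtain ⟨ω, hω_pos, hω_zero⟩ := (hf_pos.and_eventually h_zero).exists
  exact hω_pos.ne' hω_zero

variable {d : ℕ} {Ω ΩZ : Type*} [MeasurableSpace Ω] [MeasurableSpace ΩZ] {P : Measure Ω}
  [IsProbabilityMeasure P] {Q : Measure ΩZ} [IsProbabilityMeasure Q] {pY : ℕ → Ω → Mark d}
  {pZ : ℕ → ΩZ → Mark d} {Lam : Ω → Measure (Mark d)} {lam : Measure (Mark d)} {c : ℝ}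

lemma tendsto_infinitePi_disjoint_biUnion_storms (hpY : ∀ i, Measurable (pY i))
    (hCox : IsCoxProcess (pointMeasure pY) Lam P)
    (hPoisson : IsPoissonProcess (pointMeasure pZ) lam Q) (hc : 0 < c) {D : Set (Path d)}
    (hD : MeasurableSet D)
    (hscale : ∀ ω a, 0 < a → Lam ω (stormShape ⁻¹' ((a • ·) ⁻¹' D)) =
      ENNReal.ofReal a * Lam ω (stormShape ⁻¹' D))
    (hmean : lam (stormShape ⁻¹' D) = ENNReal.ofReal c * ∫⁻ ω, Lam ω (stormShape ⁻¹' D) ∂P)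
    (hfin : ∫⁻ ω, Lam ω (stormShape ⁻¹' D) ∂P ≠ ∞) :
    Tendsto (fun n : ℕ => Measure.infinitePi (fun _ : ℕ => P)
        {ω | Disjoint (⋃ i ∈ Finset.range (n + 1), (c / ((n : ℝ) + 1)) • storms pY (ω i)) D})
      atTop (𝓝 (Q {ω | Disjoint (storms pZ ω) D})) := by
  have h_shape {D' : Set (Path d)} (hD' : MeasurableSet D') :
      MeasurableSet (stormShape ⁻¹' D') := continuous_stormShape.measurable hD'
  have h_lam_fin : lam (stormShape ⁻¹' D) < ∞ :=
    hmean ▸ ENNReal.mul_lt_top ENNReal.ofReal_lt_top hfin.lt_top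
  rw [setOf_disjoint_storms,
    hPoisson.isCoxProcess.measure_disjoint_range (h_shape hD) (ae_of_all _ fun _ => h_lam_fin),
    lintegral_const, measure_univ, mul_one, hmean]
  refine (hCox.tendsto_measure_disjoint_range_pow (h_shape hD) hfin hc.le
    (fun n => h_shape (measurableSet_preimage_smul (c / ((n : ℝ) + 1)) hD))
    fun n ω => hscale ω _ (by positivity)).congr fun n => ?_
  rw [(isRandomSet_storms hpY).infinitePi_disjoint_biUnion_smul _ _ hD, Finset.card_range,
    setOf_disjoint_storms]

lemma tendstoInDistribution_smul_maxFirst (hpY : ∀ i, Measurable (pY i))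
    (hpZ : ∀ i, Measurable (pZ i)) (hCox : IsCoxProcess (pointMeasure pY) Lam P)
    (hPoisson : IsPoissonProcess (pointMeasure pZ) lam Q) (hc : 0 < c)
    (hscale : ∀ D, MeasurableSet D → ∀ ω a, 0 < a →
      Lam ω (stormShape ⁻¹' ((a • ·) ⁻¹' D)) = ENNReal.ofReal a * Lam ω (stormShape ⁻¹' D))
    (hmean : ∀ D, MeasurableSet D →
      lam (stormShape ⁻¹' D) = ENNReal.ofReal c * ∫⁻ ω, Lam ω (stormShape ⁻¹' D) ∂P)
    (hfin : ∀ K, IsCompact K → ∀ η > 0, ∫⁻ ω, Lam ω (stormShape ⁻¹' exceedSet K η) ∂P ≠ ∞)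
    (hY : ∀ᵐ ω ∂P, HasFiniteExceedances (storms pY ω))
    (hZ : ∀ᵐ ω ∂Q, HasFiniteExceedances (storms pZ ω))
    {Ω' : Type*} [MeasurableSpace Ω'] {P' : Measure Ω'} [IsProbabilityMeasure P']
    {Yc : ℕ → Ω' → Path d} (hYc : AreIIDCopies Yc P' (fun ω => toPath (extremalField pY ω)) P) :
    TendstoInDistribution (fun (n : ℕ) ω => (c / ((n : ℝ) + 1)) • maxFirst Yc n ω) atTop
      (fun ω => toPath (extremalField pZ ω)) (fun _ => P') Q := by
  have hY_meas := (finiteAndSampleContinuous_extremalField hpY hY).2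
  have hY_copies := areIIDCopies_infinitePi hY_meas
  have h_ident (n : ℕ) := (hYc.identDistrib_maxFirst hY_copies n).comp
    (continuous_const_smul (c / ((n : ℝ) + 1))).measurable
  refine tendstoInDistribution_of_identDistrib_left ?_ h_ident
  refine tendstoInDistribution_of_tendsto_avoidance (isRandomSet_storms hpZ)
    (fun n => (isRandomSet_storms hpY).biUnion_smul_eval (c / ((n : ℝ) + 1)) (Finset.range (n + 1)))
    hZ (fun K hK η hη D hDK hD => ?_) (finiteAndSampleContinuous_extremalField hpZ hZ).2
    (fun n => (h_ident n).aemeasurable_snd) ?_ fun n => ?_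
  · exact tendsto_infinitePi_disjoint_biUnion_storms hpY hCox hPoisson hc hD (hscale D hD)
      (hmean D hD) (ne_top_of_le_ne_top (hfin K hK η hη)
        (lintegral_mono fun ω => measure_mono (preimage_mono hDK)))
  · filter_upwards [hZ] with ω hω using hω.isEnvelope_toPath_extremalField
  · have h_all : ∀ᵐ ω ∂Measure.infinitePi fun _ : ℕ => P,
        ∀ i, HasFiniteExceedances (storms pY (ω i)) := ae_all_iff.2 fun i =>
      (measurePreserving_eval_infinitePi (fun _ : ℕ => P) i).quasiMeasurePreserving.ae hY
    filter_upwards [h_all] with ω hω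
    have h_max : IsEnvelope (maxFirst (fun i ω => toPath (extremalField pY (ω i))) n ω)
        (⋃ i ∈ Finset.range (n + 1), storms pY (ω i)) :=
      .finset_sup' _ fun i _ => (hω i).isEnvelope_toPath_extremalField
    simpa only [smul_set_iUnion, Function.comp_apply] using
      h_max.smul (a := c / ((n : ℝ) + 1)) (by positivity)

lemma inMaxDomainOfAttraction_of_tendsto_smul {Ω' : Type*} [MeasurableSpace Ω'] {P' : Measure Ω'}
    [IsProbabilityMeasure P'] {Yc : ℕ → Ω' → Path d} {Z : ΩZ → Path d} {a : ℕ → ℝ}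
    (ha : ∀ n, 0 < a n)
    (h : TendstoInDistribution (fun n ω => a n • maxFirst Yc n ω) atTop Z (fun _ => P') Q) :
    InMaxDomainOfAttraction Yc P' Z Q := by
  refine ⟨fun n => ContinuousMap.const _ (a n), fun _ => 0, fun n _ => ha n, ?_⟩
  simp only [sub_zero]
  exact h

variable {Psi : Ω → Path d} {PX : Measure (Path d)} [IsProbabilityMeasure PX] {muY muZ : ℝ}

lemma IsStationary.lintegral_stormIntensity_exceed_ne_top (hstat : IsStationary Psi P)
    (hPsi : Measurable Psi) (hPsi_fin : ∫⁻ ω, ENNReal.ofReal (Psi ω 0) ∂P ≠ ∞)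
    (hX : StormIntegrable PX) (μ : ℝ) {K : Set (Space d)} (hK : IsCompact K) {η : ℝ}
    (hη : 0 < η) :
    ∫⁻ ω, stormIntensity μ (Psi ω) PX (stormShape ⁻¹' exceedSet K η) ∂P ≠ ∞ := by
  rw [hstat.lintegral_stormIntensity hPsi μ (measurableSet_stormShape_preimage_exceedSet K η)]
  exact ENNReal.mul_ne_top ENNReal.ofReal_ne_top
    (ENNReal.mul_ne_top hPsi_fin (baseIntensity_exceed_lt_top hX hK hη).ne)

lemma IsCoxProcess.ae_hasFiniteExceedances_storms_of_stationary
    (hCox : IsCoxProcess (pointMeasure pY) (fun ω => stormIntensity muY (Psi ω) PX) P)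
    (hstat : IsStationary Psi P) (hPsi : Measurable Psi)
    (hPsi_fin : ∫⁻ ω, ENNReal.ofReal (Psi ω 0) ∂P ≠ ∞) (hX : StormIntegrable PX) :
    ∀ᵐ ω ∂P, HasFiniteExceedances (storms pY ω) :=
  hCox.ae_hasFiniteExceedances_storms fun K hK η hη =>
    ae_lt_top ((Measure.measurable_coe (measurableSet_stormShape_preimage_exceedSet K η)).comp
      hCox.measurable_directing)
      (hstat.lintegral_stormIntensity_exceed_ne_top hPsi hPsi_fin hX muY hK hη)

lemma IsPoissonProcess.ae_hasFiniteExceedances_storms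
    (hPoisson : IsPoissonProcess (pointMeasure pZ) (stormIntensity muZ (fun _ => 1) PX) Q)
    (hX : StormIntegrable PX) : ∀ᵐ ω ∂Q, HasFiniteExceedances (storms pZ ω) := by
  refine hPoisson.isCoxProcess.ae_hasFiniteExceedances_storms fun K hK η hη =>
    ae_of_all _ fun _ => ?_
  rw [stormIntensity_one muZ (measurableSet_stormShape_preimage_exceedSet K η)]
  exact ENNReal.mul_lt_top ENNReal.ofReal_lt_top (baseIntensity_exceed_lt_top hX hK hη)

lemma tendstoInDistribution_smul_maxFirst_of_stationary (hpY : ∀ i, Measurable (pY i))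
    (hpZ : ∀ i, Measurable (pZ i))
    (hCox : IsCoxProcess (pointMeasure pY) (fun ω => stormIntensity muY (Psi ω) PX) P)
    (hPoisson : IsPoissonProcess (pointMeasure pZ) (stormIntensity muZ (fun _ => 1) PX) Q)
    (hstat : IsStationary Psi P) (hPsi : Measurable Psi)
    (hPsi_fin : ∫⁻ ω, ENNReal.ofReal (Psi ω 0) ∂P ≠ ∞) (hX : StormIntegrable PX) (hc : 0 < c)
    (hmean : ENNReal.ofReal c * (ENNReal.ofReal muY⁻¹ * ∫⁻ ω, ENNReal.ofReal (Psi ω 0) ∂P) =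
      ENNReal.ofReal muZ⁻¹)
    {Ω' : Type*} [MeasurableSpace Ω'] {P' : Measure Ω'} [IsProbabilityMeasure P']
    {Yc : ℕ → Ω' → Path d} (hYc : AreIIDCopies Yc P' (fun ω => toPath (extremalField pY ω)) P) :
    TendstoInDistribution (fun (n : ℕ) ω => (c / ((n : ℝ) + 1)) • maxFirst Yc n ω) atTop
      (fun ω => toPath (extremalField pZ ω)) (fun _ => P') Q := by
  refine tendstoInDistribution_smul_maxFirst hpY hpZ hCox hPoisson hc
    (fun D hD ω a ha => stormIntensity_stormShape_preimage_smul muY (Psi ω) ha hD)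
    (fun D hD => ?_)
    (fun K hK η hη => hstat.lintegral_stormIntensity_exceed_ne_top hPsi hPsi_fin hX muY hK hη)
    (hCox.ae_hasFiniteExceedances_storms_of_stationary hstat hPsi hPsi_fin hX)
    (hPoisson.ae_hasFiniteExceedances_storms hX) hYc
  have hD' := continuous_stormShape.measurable hD
  rw [hstat.lintegral_stormIntensity hPsi muY hD', stormIntensity_one muZ hD', ← hmean, mul_assoc,
    mul_assoc]

end Attraction

end CoxExtremal

end

open CoxExtremal in
theorem theorem1_general {d : ℕ}
    {Ω ΩZ : Type*} [MeasurableSpace Ω] [MeasurableSpace ΩZ]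
    (P : Measure Ω) [IsProbabilityMeasure P] (Q : Measure ΩZ) [IsProbabilityMeasure Q]
    (Psi : Ω → Path d) (hPsi_meas : Measurable Psi) (hPsi_stat : IsStationary Psi P)
    (hPsi_nonneg : ∀ᵐ ω ∂P, ∀ s, 0 ≤ Psi ω s) (hPsi_pos : ∃ᵐ ω ∂P, 0 < Psi ω 0)
    (hPsi_int : Integrable (fun ω => Psi ω 0) P)
    (PX : Measure (Path d)) [IsProbabilityMeasure PX]
    (_hX_nonneg : ∀ᵐ x ∂PX, ∀ s, 0 ≤ x s) (hX_int : StormIntegrable PX)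
    (muY muZ : ℝ) (hmuY : 0 < muY) (hmuZ : 0 < muZ)
    (pY : ℕ → Ω → Mark d) (hpY : ∀ i, Measurable (pY i))
    (hCox : IsCoxProcess (pointMeasure pY) (fun ω => stormIntensity muY (Psi ω) PX) P)
    (pZ : ℕ → ΩZ → Mark d) (hpZ : ∀ i, Measurable (pZ i))
    (hPoisson : IsPoissonProcess (pointMeasure pZ) (stormIntensity muZ (fun _ => 1) PX) Q) :
    FiniteAndSampleContinuous (extremalField pY) P ∧
    FiniteAndSampleContinuous (extremalField pZ) Q ∧
    ∀ {Ω' : Type*} [MeasurableSpace Ω'] (P' : Measure Ω') [IsProbabilityMeasure P']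
      (Yc : ℕ → Ω' → Path d),
      AreIIDCopies Yc P' (fun ω => toPath (extremalField pY ω)) P →
      InMaxDomainOfAttraction Yc P' (fun ω => toPath (extremalField pZ ω)) Q ∧
      (muZ = muY / ∫ ω, Psi ω 0 ∂P →
        TendstoInDistribution (fun (n : ℕ) ω => ((n + 1 : ℕ) : ℝ)⁻¹ • maxFirst Yc n ω) atTop
          (fun ω => toPath (extremalField pZ ω)) (fun _ => P') Q) := by
  have h_nonneg : 0 ≤ᵐ[P] fun ω => Psi ω 0 := hPsi_nonneg.mono fun ω hω => hω 0
  have h_mean_pos : 0 < ∫ ω, Psi ω 0 ∂P :=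
    integral_pos_of_frequently_pos hPsi_int h_nonneg hPsi_pos
  have h_mean := (ofReal_integral_eq_lintegral_ofReal hPsi_int h_nonneg).symm
  have h_fin := h_mean ▸ ENNReal.ofReal_ne_top
  refine ⟨finiteAndSampleContinuous_extremalField hpY
      (hCox.ae_hasFiniteExceedances_storms_of_stationary hPsi_stat hPsi_meas h_fin hX_int),
    finiteAndSampleContinuous_extremalField hpZ (hPoisson.ae_hasFiniteExceedances_storms hX_int),
    fun P' _ Yc hYc => ?_⟩
  have h_conv {c : ℝ} (hc : 0 < c) (hc_eq : c * (muY⁻¹ * ∫ ω, Psi ω 0 ∂P) = muZ⁻¹) :=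
    tendstoInDistribution_smul_maxFirst_of_stationary hpY hpZ hCox hPoisson hPsi_stat hPsi_meas
      h_fin hX_int hc (by
        rw [h_mean, ← ENNReal.ofReal_mul (inv_nonneg.2 hmuY.le), ← ENNReal.ofReal_mul hc.le,
          hc_eq]) hYc
  refine ⟨inMaxDomainOfAttraction_of_tendsto_smul
    (a := fun n => muY / ((∫ ω, Psi ω 0 ∂P) * muZ) / ((n : ℝ) + 1)) (fun n => by positivity)
    (h_conv (by positivity) (by field_simp)), fun h_muZ => ?_⟩
  simpa only [one_div, Nat.cast_add, Nat.cast_one] using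
    h_conv one_pos (by rw [h_muZ, inv_div]; ring)

theorem theorem1 {d : ℕ}
    {Ω ΩZ : Type*} [MeasurableSpace Ω] [MeasurableSpace ΩZ]
    (P : Measure Ω) [IsProbabilityMeasure P] (Q : Measure ΩZ) [IsProbabilityMeasure Q]
    -- the intensity process
    (Psi : Ω → CoxExtremal.Path d) (hPsi_meas : Measurable Psi)
    (hPsi_stat : CoxExtremal.IsStationary Psi P)
    (hPsi_pos : ∀ᵐ ω ∂P, ∀ s, 0 < Psi ω s)
    (hPsi_int : Integrable (fun ω => Psi ω 0) P)
    -- the law of the storm process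
    (PX : Measure (CoxExtremal.Path d)) [IsProbabilityMeasure PX]
    (hX_nonneg : ∀ᵐ x ∂PX, ∀ s, 0 ≤ x s)
    (hX_int : CoxExtremal.StormIntegrable PX) (hX_supp : CoxExtremal.StormSupport PX)
    -- the scaling constants
    (muY muZ : ℝ) (hmuY : 0 < muY) (hmuZ : 0 < muZ)
    -- the points of the Cox process underlying `Y` and of the Poisson process underlying `Z`
    (pY : ℕ → Ω → CoxExtremal.Mark d) (hpY : ∀ i, Measurable (pY i))
    (hCox : CoxExtremal.IsCoxProcess (CoxExtremal.pointMeasure pY)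
      (fun ω => CoxExtremal.stormIntensity muY (Psi ω) PX) P)
    (pZ : ℕ → ΩZ → CoxExtremal.Mark d) (hpZ : ∀ i, Measurable (pZ i))
    (hPoisson : CoxExtremal.IsPoissonProcess (CoxExtremal.pointMeasure pZ)
      (CoxExtremal.stormIntensity muZ (fun _ => 1) PX) Q) :
    CoxExtremal.FiniteAndSampleContinuous (CoxExtremal.extremalField pY) P ∧
    CoxExtremal.FiniteAndSampleContinuous (CoxExtremal.extremalField pZ) Q ∧
    ∀ {Ω' : Type*} [MeasurableSpace Ω'] (P' : Measure Ω') [IsProbabilityMeasure P']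
      (Yc : ℕ → Ω' → CoxExtremal.Path d),
      CoxExtremal.AreIIDCopies Yc P'
        (fun ω => CoxExtremal.toPath (CoxExtremal.extremalField pY ω)) P →
      CoxExtremal.InMaxDomainOfAttraction Yc P'
        (fun ω => CoxExtremal.toPath (CoxExtremal.extremalField pZ ω)) Q ∧
      ∀ t₀ : CoxExtremal.Space d,
        ENNReal.ofReal muY = CoxExtremal.meanStormIntegral Psi P PX t₀ →
        muZ = muY / ∫ ω, Psi ω 0 ∂P →
        TendstoInDistribution
          (fun (n : ℕ) ω => ((n + 1 : ℕ) : ℝ)⁻¹ • CoxExtremal.maxFirst Yc n ω) atTop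
          (fun ω => CoxExtremal.toPath (CoxExtremal.extremalField pZ ω)) (fun _ => P') Q := by
  have h := theorem1_general P Q Psi hPsi_meas hPsi_stat
    (hPsi_pos.mono fun ω hω s => (hω s).le) (hPsi_pos.mono fun ω hω => hω 0).frequently hPsi_int
    PX hX_nonneg hX_int muY muZ hmuY hmuZ pY hpY hCox pZ hpZ hPoisson
  exact ⟨h.1, h.2.1, fun P' _ Yc hYc =>
    (h.2.2 P' Yc hYc).imp_right fun h_conv _ _ => h_conv⟩
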